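/- **Programs.** A rule $r$ is $a_1\vee\dots\vee a_\ell\leftarrow a_{\ell+1},\dots,a_m,\neg a_{m+1},\dots,\neg a_n$ with distinct atoms; $H_r=\{a_1,\dots,a_\ell\}$, $B_r^+=\{a_{\ell+1},\dots,a_m\}$, $B_r^-=\{a_{m+1},\dots,a_n\}$, $\mathrm{at}(r)=H_r\cup B_r^+\cup B_r^-$. A program $\Pi$ is a finite set of rules, $\mathrm{at}(\Pi)=\bigcup_{r\in\Pi}\mathrm{at}(r)$. A set $I$ of atoms satisfies $r$ if $(H_r\cup B_r^-)\cap I\ne\emptyset$ or $B_r^+\setminus I\neq\emptyset$; it is a model of $\Pi$ ($I\models\Pi$) if it satisfies all rules of $\Pi$; it is an answer set of $\Pi$ if it is a $\subseteq$-minimal model of the Gelfond–Lifschitz reduct $\Pi^I=\{H_r\leftarrow B_r^+ : r\in\Pi,\ B_r^-\cap I=\emptyset\}$. $\Pi$ is head-cycle-free if no directed cycle (closed walk) of the digraph with the arcs $(a,b)$, $a\in B^+_r$, $b\in H_r$, $r\in\Pi$, contains two distinct atoms of the head of one rule. The primal graph $G_\Pi$ has vertex set $\mathrm{at}(\Pi)$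 and an edge between any two distinct atoms that occur in a common rule. **Tree decompositions.** A tree decomposition $(T,\chi)$ of $G_\Pi$ consists of a rooted tree $T$ with root $n$, in which the children of each node are listed in a fixed order, and bags $\chi(t)\subseteq\mathrm{at}(\Pi)$ that cover all vertices and all edges and satisfy $\chi(r)\cap\chi(t)\subseteq\chi(s)$ whenever $s$ lies on the path from $r$ to $t$. It is nice if the bags of the root and of all leaves are empty and each node $t$ is a leaf; or an introduce node (one child $t'$, $\chi(t')\subseteq\chi(t)$, $|\chi(t)|=|\chi(t')|+1$); or a removal node (one child $t'$, $\chi(t)\subseteq\chi(t')$, $|\chi(t')|=|\chi(t)|+1$); or a join node (two children $t',t''$, $\chi(t)=\chi(t')=\chi(t'')\neq\emptyset$). Put $\Pi_t=\{r\in\Pi:\mathrm{at}(r)\subseteq\chi(t)\}$. **Algorithm.** Rows are triples $\langle I,\mathcal P,\sigma\rangle$ of an interpretation $I$, a set $\mathcal P$ of atoms (those already proven) and a sequence $\sigma$ of atoms. Write $b<_\sigma a$ if $b$ occurs before $a$ in $\sigma$. Let $\mathrm{gp}(I,\sigma,\Pi_t)$ be the set of atoms $a$ for which there is $r\in\Pi_t$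 with $a\in H_r$, $B_r^+\subseteq I$, $I\cap B_r^-=\emptyset$, $I\cap(H_r\setminus\{a\})=\emptyset$ and $b<_\sigma a$ for all $b\in B_r^+$. The algorithm $\mathrm{DP}_{\mathrm{PHC}}$ traverses $T$ in post-order and computes at each node $t$ with children $t_1,\dots,t_\ell$ the table $\tau(t)=\mathrm{PHC}(t,\chi(t),\Pi_t,\langle\tau(t_1),\dots,\tau(t_\ell)\rangle)$, where $\mathrm{PHC}$, applied to child tables $\tau_1,\dots,\tau_\ell$, returns - leaf: $\{\langle\emptyset,\emptyset,\langle\rangle\rangle\}$; - introduction of $a$: all $\langle J,\mathcal P\cup\mathrm{gp}(J,\sigma',\Pi_t),\sigma'\rangle$ with $\langle I,\mathcal P,\sigma\rangle\in\tau_1$, $J\in\{I,I\cup\{a\}\}$, $J\models\Pi_t$, where $\sigma'=\sigma$ if $a\notin J$, and $\sigma'$ arises from $\sigma$ by inserting $a$ at any position if $a\in J$; - removal of $a$: all $\langle I\setminus\{a\},\mathcal P\setminus\{a\},\sigma\text{ without }a\rangle$ with $\langle I,\mathcal P,\sigma\rangle\in\tau_1$ and ($a\in\mathcal P$ or $a\notin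 I$); - join: all $\langle I,\mathcal P_1\cup\mathcal P_2,\sigma\rangle$ with $\langle I,\mathcal P_1,\sigma\rangle\in\tau_1$ and $\langle I,\mathcal P_2,\sigma\rangle\in\tau_2$. **Origins, extensions and solutions.** The origins of a row $u$ at $t$ are the sequences $\langle s_1,\dots,s_\ell\rangle\in\tau(t_1)\times\dots\times\tau(t_\ell)$ with $u\in\mathrm{PHC}(t,\chi(t),\Pi_t,\langle\{s_1\},\dots,\{s_\ell\}\rangle)$. The only extension of $u$ below a leaf $t$ is $\{\langle t,u\rangle\}$; the extensions of $u$ below an inner node $t$ are the sets $\{\langle t,u\rangle\}\cup X_1\cup\dots\cup X_\ell$, where $\langle s_1,\dots,s_\ell\rangle$ is an origin of $u$ at $t$ and each $X_i$ is an extension of $s_i$ below $t_i$. The interpretation of an extension is the union of the interpretations $I$ of its rows. Let $\Pi_{\le t}$ be the union of the $\Pi_{t'}$, and $\mathrm{at}_{\le t}$ the union of the $\chi(t')$, over the nodes $t'$ of the subtree rooted at $t$. A PHC-solution up to $t$ is a triple $\langle\hat I,\hat{\mathcal P},\hat\sigma\rangle$ such that $\hat I\subseteq\mathrm{at}_{\le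 t}$, $\hat{\mathcal P}\subseteq\hat I$, $\hat\sigma$ lists every element of $\hat I$ exactly once, $\hat I\models\Pi_{\le t}$, $\hat I\cap(\mathrm{at}_{\le t}\setminus\chi(t))\subseteq\hat{\mathcal P}$, and $\hat{\mathcal P}=\hat I\cap\mathrm{gp}(\hat I,\hat\sigma,\Pi_{\le t})$. **Theorem.** Let $\Pi$ be a head-cycle-free program other than the program whose only rule is the rule $\bot\leftarrow$ without atoms, and let $(T,\chi)$ be a nice tree decomposition of $G_\Pi$ with root $n$. Let $\tau$ be the tables computed by $\mathrm{DP}_{\mathrm{PHC}}$. Then 1. for every node $t$ and every row $\langle I,\mathcal P,\sigma\rangle\in\tau(t)$ we have $I\subseteq\chi(t)$, $\mathcal P\subseteq I$, and $\sigma$ lists every element of $I$ exactly once; 2. $\Pi$ has an answer set if and only if $\langle\emptyset,\emptyset,\langle\rangle\rangle\in\tau(n)$; 3. the set of interpretations of the extensions below $n$ of the rows of $\tau(n)$ equals $\{\hat I:\langle\hat I,\hat{\mathcal P},\hat\sigma\rangle\text{ is a PHC-solution up to }n\}$, and this set equals the set of all answer sets of $\Pi$. -/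

import Mathlib

namespace ASP

/-! Propositional disjunctive programs and their answer sets. -/

/-- A disjunctive rule `a₁ ∨ ⋯ ∨ a_ℓ ← a_{ℓ+1}, …, a_m, ¬ a_{m+1}, …, ¬ a_n` over pairwise
distinct atoms, given by its head, its positive body and its negative body. -/
structure Rule (α : Type*) where
  head : Finset α
  pos : Finset α
  neg : Finset α
  head_pos : Disjoint head pos
  head_neg : Disjoint head neg
  pos_neg : Disjoint pos neg
  deriving DecidableEq

/-- A program is a finite set of rules. -/
abbrev Program (α : Type*) := Finset (Rule α)

section Programs

variable {α : Type*} [DecidableEq α]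

/-- The rule `⊥ ←` without any atom. -/
def Rule.empty : Rule α := ⟨∅, ∅, ∅, by simp, by simp, by simp⟩

/-- Atoms of a rule. -/
def Rule.atoms (r : Rule α) : Finset α := r.head ∪ r.pos ∪ r.neg

/-- Atoms of a program. -/
def Program.atoms (P : Program α) : Finset α := P.biUnion Rule.atoms

/-- The interpretation `I` satisfies the rule `r`. -/
def Rule.Sat (I : Finset α) (r : Rule α) : Prop :=
  (r.head ∪ r.neg) ∩ I ≠ ∅ ∨ r.pos \ I ≠ ∅

instance (I : Finset α) (r : Rule α) : Decidable (r.Sat I) :=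
  inferInstanceAs (Decidable (_ ∨ _))

/-- `I` is a model of `P`. -/
def IsModel (I : Finset α) (P : Program α) : Prop := ∀ r ∈ P, r.Sat I

instance (I : Finset α) (P : Program α) : Decidable (IsModel I P) :=
  inferInstanceAs (Decidable (∀ r ∈ P, r.Sat I))

/-- The rule with its negative body deleted. -/
def Rule.dropNeg (r : Rule α) : Rule α :=
  ⟨r.head, r.pos, ∅, r.head_pos, by simp, by simp⟩

/-- The Gelfond–Lifschitz reduct of `P` under `I`. -/
def Program.reduct (P : Program α) (I : Finset α) : Program α :=
  (P.filter fun r => r.neg ∩ I = ∅).image Rule.dropNeg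

/-- `I` is an answer set of `P`: a subset-minimal model of the reduct of `P` under `I`. -/
def IsAnswerSet (P : Program α) (I : Finset α) : Prop :=
  IsModel I (P.reduct I) ∧ ∀ J, J ⊂ I → ¬ IsModel J (P.reduct I)

/-- Arcs `(a, b)` of the positive dependency digraph. -/
def DepArc (P : Program α) (a b : α) : Prop := ∃ r ∈ P, a ∈ r.pos ∧ b ∈ r.head

/-- No directed cycle of the positive dependency digraph contains two distinct atoms of the head
of one rule. Cycles are closed directed walks, which may repeat vertices. -/
def HeadCycleFree (P : Program α) : Prop :=
  ¬ ∃ r ∈ P, ∃ a ∈ r.head, ∃ b ∈ r.head, a ≠ b ∧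
    ∃ c : Cycle α, c.Chain (DepArc P) ∧ a ∈ c ∧ b ∈ c

/-- `σ` is an ordering of the set `I`: a sequence listing every element of `I` exactly once. -/
def IsOrdering (σ : List α) (I : Finset α) : Prop := σ.Nodup ∧ σ.toFinset = I

/-- `b <_σ a`: `b` occurs before `a` in the sequence `σ`. -/
def Before (σ : List α) (b a : α) : Prop := [b, a].Sublist σ

instance (σ : List α) (b a : α) : Decidable (Before σ b a) :=
  inferInstanceAs (Decidable ([b, a].Sublist σ))

/-- `a ∈ I` is proven using the program `P` and the ordering `σ`. -/
def Proven (P : Program α) (I : Finset α) (σ : List α) (a : α) : Prop :=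
  a ∈ I ∧ ∃ r ∈ P, a ∈ r.head ∧ r.pos ⊆ I ∧ (∀ b ∈ r.pos, Before σ b a) ∧
    I ∩ r.neg = ∅ ∧ I ∩ (r.head \ {a}) = ∅

/-- The primal graph of `P`; its vertex set is `P.atoms`. -/
def primalGraph (P : Program α) : SimpleGraph α where
  Adj a b := a ≠ b ∧ ∃ r ∈ P, a ∈ r.atoms ∧ b ∈ r.atoms
  symm := ⟨fun _ _ ⟨h, r, hr, ha, hb⟩ => ⟨h.symm, r, hr, hb, ha⟩⟩
  loopless := ⟨fun _ h => h.1 rfl⟩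

end Programs

/-! Rooted trees and tree decompositions. -/

/-- A rooted tree with node set `N` in which the children of every node are listed in a fixed
order: the underlying undirected graph is a tree and all arcs point away from the root. -/
structure OrdTree (N : Type*) where
  root : N
  children : N → List N
  nodup_children : ∀ t, (children t).Nodup
  isTree : (SimpleGraph.fromRel fun t t' => t' ∈ children t).IsTree
  dist_child : ∀ t, ∀ t' ∈ children t,
    (SimpleGraph.fromRel fun t t' => t' ∈ children t).dist root t' =
      (SimpleGraph.fromRel fun t t' => t' ∈ children t).dist root t + 1

section Trees

variable {N : Type*}

/-- The underlying undirected graph. -/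
def OrdTree.graph (T : OrdTree N) : SimpleGraph N :=
  SimpleGraph.fromRel fun t t' => t' ∈ T.children t

theorem OrdTree.dist_lt_card [Fintype N] (T : OrdTree N) (t : N) :
    T.graph.dist T.root t < Fintype.card N := by
  obtain ⟨p, hp, hl⟩ := T.isTree.1.exists_path_of_dist T.root t
  have := hp.length_lt
  unfold OrdTree.graph
  omega

/-- The post-order sequence of the nodes of the subtree rooted at `t`. -/
def OrdTree.postOrder [Fintype N] (T : OrdTree N) (t : N) : List N :=
  ((T.children t).attach.flatMap fun c => T.postOrder c.1) ++ [t]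
termination_by Fintype.card N - T.graph.dist T.root t
decreasing_by
  have h1 := T.dist_lt_card c.1
  have h2 := T.dist_child t c.1 c.2
  unfold OrdTree.graph at *
  omega

/-- `(T, χ)` is a tree decomposition of the graph with vertex set `V` and edges as in `G`. -/
structure IsTreeDecomposition {α : Type*} [DecidableEq α] (V : Finset α) (G : SimpleGraph α)
    (T : OrdTree N) (χ : N → Finset α) : Prop where
  bag_subset : ∀ t, χ t ⊆ V
  cover_vertex : ∀ v ∈ V, ∃ t, v ∈ χ t
  cover_edge : ∀ u v, G.Adj u v → ∃ t, u ∈ χ t ∧ v ∈ χ t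
  path : ∀ r s t, ∀ p : T.graph.Walk r t, p.IsPath → s ∈ p.support → χ r ∩ χ t ⊆ χ s

/-- The types of nodes in nice tree decompositions, together with the children of the node. -/
inductive NodeType (N : Type*) where
  | leaf
  | int (t' : N)
  | rem (t' : N)
  | join (t' t'' : N)

/-- The type of the node `t`, if it has one. -/
def nodeType {α : Type*} [DecidableEq α] (T : OrdTree N) (χ : N → Finset α) (t : N) :
    Option (NodeType N) :=
  match T.children t with
  | [] => some .leaf
  | [t'] =>
    if χ t' ⊆ χ t ∧ (χ t).card = (χ t').card + 1 then some (.int t')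
    else if χ t ⊆ χ t' ∧ (χ t').card = (χ t).card + 1 then some (.rem t')
    else none
  | [t', t''] => if χ t = χ t' ∧ χ t = χ t'' ∧ χ t ≠ ∅ then some (.join t' t'') else none
  | _ => none

/-- Every node has a type, and the bags of the root and of all leaves are empty. -/
structure IsNice {α : Type*} [DecidableEq α] (T : OrdTree N) (χ : N → Finset α) : Prop where
  has_type : ∀ t, nodeType T χ t ≠ none
  root_empty : χ T.root = ∅
  leaf_empty : ∀ t, nodeType T χ t = some .leaf → χ t = ∅

end Trees

/-! Dynamic programming on tree decompositions. -/

section DP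

variable {α N : Type*} [DecidableEq α] [Fintype N] [DecidableEq N]

/-- The bag-program of a bag: the rules all of whose atoms are in the bag. -/
def bagProgram (P : Program α) (bag : Finset α) : Program α := P.filter fun r => r.atoms ⊆ bag

/-- The algorithm `DP_A` for a table algorithm `A`, which receives the node, its bag, its
bag-program and the tables of the children. The nodes are visited in post-order. Tables are finite
sets of rows, and initially all tables are empty. -/
def dynProg {R : Type*}
    (A : N → Finset α → Program α → List (Finset R) → Finset R)
    (P : Program α) (T : OrdTree N) (χ : N → Finset α) : N → Finset R :=
  (T.postOrder T.root).foldl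
    (fun o t => Function.update o t (A t (χ t) (bagProgram P (χ t)) ((T.children t).map o)))
    (fun _ => ∅)

/-- Rows `⟨I, 𝒫, σ⟩` of an interpretation, a set of (proven) atoms and a sequence of atoms. -/
abbrev Row (α : Type*) := Finset α × Finset α × List α

/-- The atoms that are proven by a rule of `P` with respect to `I` and `σ`. -/
def gatherProof (I : Finset α) (σ : List α) (P : Program α) : Finset α :=
  P.biUnion fun r => r.head.filter fun a =>
    r.pos ⊆ I ∧ I ∩ r.neg = ∅ ∧ I ∩ (r.head \ {a}) = ∅ ∧ ∀ b ∈ r.pos, Before σ b a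

/-- The sequences that arise from `σ` by inserting one element of `A` (`σ` itself if `A = ∅`). -/
def possOrd (σ : List α) (A : Finset α) : Finset (List α) :=
  (if A = ∅ then {σ} else ∅) ∪
    A.biUnion fun a => (Finset.range (σ.length + 1)).image fun i => σ.insertIdx i a

/-- The table algorithm `PHC`. At introduce and removal nodes, the set over which `a` ranges
consists of the single introduced or removed atom. -/
def PHC (T : OrdTree N) (χ : N → Finset α) (t : N) (bag : Finset α) (Pt : Program α)
    (tabs : List (Finset (Row α))) : Finset (Row α) :=
  match nodeType T χ t, tabs with
  | some .leaf, _ => {(∅, ∅, [])}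
  | some (.int t'), [τ₁] =>
    (bag \ χ t').biUnion fun a =>
      τ₁.biUnion fun (I, Q, σ) =>
        (({I, insert a I} : Finset (Finset α)).filter fun J => IsModel J Pt).biUnion fun J =>
          (possOrd σ ({a} ∩ J)).image fun σ' => (J, Q ∪ gatherProof J σ' Pt, σ')
  | some (.rem t'), [τ₁] =>
    (χ t' \ bag).biUnion fun a =>
      (τ₁.filter fun (I, Q, _) => a ∈ Q ∪ ({a} \ I)).image fun (I, Q, σ) =>
        (I.erase a, Q.erase a, σ.erase a)
  | some (.join _ _), [τ₁, τ₂] =>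
    τ₁.biUnion fun (I, Q₁, σ) =>
      (τ₂.filter fun (I', _, σ') => I' = I ∧ σ' = σ).image fun (_, Q₂, _) => (I, Q₁ ∪ Q₂, σ)
  | _, _ => ∅

/-- The tables computed by `DP_PHC`. -/
def dpPHC (P : Program α) (T : OrdTree N) (χ : N → Finset α) : N → Finset (Row α) :=
  dynProg (PHC T χ) P T χ

/-- The origins of the row `u` in the node `t` with respect to the tables `τ`: sequences of rows,
one from the table of every child, from which `PHC` produces `u`. -/
def origins (P : Program α) (T : OrdTree N) (χ : N → Finset α) (τ : N → Finset (Row α))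
    (t : N) (u : Row α) : Set (Fin (T.children t).length → Row α) :=
  {s | (∀ i, s i ∈ τ ((T.children t).get i)) ∧
    u ∈ PHC T χ t (χ t) (bagProgram P (χ t)) (List.ofFn fun i => {s i})}

/-- `IsExtension P T χ τ t u X`: the set `X` of pairs of nodes and rows is an extension below `t`
of the row `u`, i.e. it is obtained from `u` by transitively following origins to the leaves. -/
inductive IsExtension (P : Program α) (T : OrdTree N) (χ : N → Finset α)
    (τ : N → Finset (Row α)) : N → Row α → Finset (N × Row α) → Prop
  | leaf (t : N) (u : Row α) (ht : T.children t = []) : IsExtension P T χ τ t u {(t, u)}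
  | node (t : N) (u : Row α) (ht : T.children t ≠ [])
      (s : Fin (T.children t).length → Row α) (hs : s ∈ origins P T χ τ t u)
      (X : Fin (T.children t).length → Finset (N × Row α))
      (hX : ∀ i, IsExtension P T χ τ ((T.children t).get i) (s i) (X i)) :
      IsExtension P T χ τ t u ({(t, u)} ∪ Finset.univ.biUnion X)

/-- The extensions below `t` of the rows of a table `ρ`. -/
def extensions (P : Program α) (T : OrdTree N) (χ : N → Finset α) (τ : N → Finset (Row α))
    (t : N) (ρ : Finset (Row α)) : Set (Finset (N × Row α)) :=
  {X | ∃ u ∈ ρ, IsExtension P T χ τ t u X}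

/-- The set of interpretations of a family of extensions. -/
def interpretations (E : Set (Finset (N × Row α))) : Set (Finset α) :=
  {I | ∃ X ∈ E, I = X.biUnion fun p => p.2.1}

/-- The nodes of the subtree rooted at `t`. -/
def below (T : OrdTree N) (t : N) : Finset N := (T.postOrder t).toFinset

/-- The program below `t`. -/
def programBelow (P : Program α) (T : OrdTree N) (χ : N → Finset α) (t : N) : Program α :=
  (below T t).biUnion fun t' => bagProgram P (χ t')

/-- The atoms below `t`. -/
def atomsBelow (T : OrdTree N) (χ : N → Finset α) (t : N) : Finset α := (below T t).biUnion χ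

/-- `⟨I, Q, σ⟩` is a `PHC`-solution up to `t`. -/
structure IsPHCSolution (P : Program α) (T : OrdTree N) (χ : N → Finset α) (t : N)
    (I Q : Finset α) (σ : List α) : Prop where
  subset_atoms : I ⊆ atomsBelow T χ t
  proven_subset : Q ⊆ I
  ordering : IsOrdering σ I
  model : IsModel I (programBelow P T χ t)
  strictly_below : ∀ a ∈ I ∩ (atomsBelow T χ t \ χ t), a ∈ Q
  mem_iff : ∀ a, a ∈ Q ↔ Proven (programBelow P T χ t) I σ a

end DP

end ASP

/-!
For a head-cycle-free program, a model `I` is an answer set iff its atoms can be ordered so that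
each of them is proven by a rule whose positive body precedes it. Such an ordering leaves no room
for a smaller model of the reduct. Conversely, deleting an initial strongly connected component of
the atoms not yet proven from an answer set violates a rule of the reduct, and
head-cycle-freeness makes this rule prove the next atom.

Call a model of the program below `t`, with an ordering of its atoms, a partial solution if every
atom outside the bag of `t` is proven. Its trace on the bag is a row, and by induction on `t` the
rows of the table of `t`, paired with the interpretations of their extensions, are precisely the
traces of partial solutions, paired with their models: the connectedness of tree decompositions
places the atoms common to two parts in the bag, and two orderings that agree on the common atoms
can be merged. At the root the bag is empty, so there all atoms of a partial solution are proven.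
-/

namespace ASP

/-! ### Rooted trees -/

namespace OrdTree

variable {N : Type*} {T : OrdTree N} {c c' s t t' x y : N}

/-- The arcs of a rooted tree, from a node to its children. -/
def IsChild (T : OrdTree N) (t c : N) : Prop := c ∈ T.children t

/-- The distance of a node from the root, the rank for inductions over a rooted tree. -/
noncomputable def depth (T : OrdTree N) (t : N) : ℕ := T.graph.dist T.root t

/-- The subtree relation: the node `s` belongs to the subtree rooted at `t`. -/
def IsBelow (T : OrdTree N) (t s : N) : Prop := Relation.ReflTransGen T.IsChild t s

theorem isTree_graph (T : OrdTree N) : T.graph.IsTree := T.isTree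

theorem IsChild.depth_eq (h : T.IsChild t c) : T.depth c = T.depth t + 1 := T.dist_child t c h

theorem IsChild.adj (h : T.IsChild t c) : T.graph.Adj t c := by
  have hne : t ≠ c := by
    rintro rfl
    have := h.depth_eq
    omega
  exact (SimpleGraph.fromRel_adj _ _ _).2 ⟨hne, Or.inl h⟩

theorem isChild_or_isChild_of_adj (h : T.graph.Adj x y) : T.IsChild x y ∨ T.IsChild y x :=
  ((SimpleGraph.fromRel_adj _ _ _).1 h).2

theorem IsChild.exists_isPath_penultimate_eq (h : T.IsChild t c) :
    ∃ w : T.graph.Walk T.root c, w.IsPath ∧ w.penultimate = t := by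
  obtain ⟨w, -, hw⟩ := T.isTree_graph.1.exists_path_of_dist T.root t
  refine ⟨w.concat h.adj, SimpleGraph.Walk.isPath_of_length_eq_dist _ ?_, by simp⟩
  rw [SimpleGraph.Walk.length_concat, hw]
  exact h.depth_eq.symm

theorem IsChild.parent_unique (h : T.IsChild t c) (h' : T.IsChild t' c) : t = t' := by
  obtain ⟨w, hw, rfl⟩ := h.exists_isPath_penultimate_eq
  obtain ⟨w', hw', rfl⟩ := h'.exists_isPath_penultimate_eq
  have hww' := (T.isTree_graph.2.subsingleton_path _ _).elim ⟨w, hw⟩ ⟨w', hw'⟩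
  exact congrArg (fun p => p.1.penultimate) hww'

theorem IsBelow.refl (t : N) : T.IsBelow t t := Relation.ReflTransGen.refl

theorem isBelow_iff : T.IsBelow t s ↔ s = t ∨ ∃ c ∈ T.children t, T.IsBelow c s :=
  Relation.ReflTransGen.cases_head_iff.trans (or_congr eq_comm Iff.rfl)

theorem IsBelow.depth_le (h : T.IsBelow t s) : T.depth t ≤ T.depth s := by
  induction h with
  | refl => exact le_rfl
  | tail _ hc ih => exact ih.trans (by rw [hc.depth_eq]; omega)

theorem IsChild.not_isBelow (h : T.IsChild t c) : ¬ T.IsBelow c t := fun hct => by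
  have := hct.depth_le
  rw [h.depth_eq] at this
  omega

theorem eq_of_isBelow_siblings (hc : T.IsChild t c) (hc' : T.IsChild t c')
    (hs : T.IsBelow c s) (hs' : T.IsBelow c' s) : c = c' := by
  induction hs with
  | refl =>
    obtain h | ⟨p, hp, hpc⟩ := Relation.ReflTransGen.cases_tail hs'
    · exact h
    · exact absurd (hpc.parent_unique hc ▸ hp) hc'.not_isBelow
  | tail hcs hsx ih =>
    obtain rfl | ⟨p, hp, hpx⟩ := Relation.ReflTransGen.cases_tail hs'
    · exact absurd (hsx.parent_unique hc' ▸ hcs) hc.not_isBelow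
    · exact ih (hpx.parent_unique hsx ▸ hp)

theorem eq_and_isChild_of_adj (hx : T.IsBelow c x) (hy : ¬ T.IsBelow c y)
    (h : T.graph.Adj x y) : x = c ∧ T.IsChild y c := by
  obtain hxy | hyx := isChild_or_isChild_of_adj h
  · exact absurd (hx.tail hxy) hy
  · obtain rfl | ⟨p, hp, hpx⟩ := Relation.ReflTransGen.cases_tail hx
    · exact ⟨rfl, hyx⟩
    · exact absurd (hpx.parent_unique hyx ▸ hp) hy

theorem isBelow_root (T : OrdTree N) (t : N) : T.IsBelow T.root t := by
  by_contra ht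
  obtain ⟨w⟩ := T.isTree_graph.1.preconnected T.root t
  obtain ⟨d, -, hfst, hsnd⟩ := w.exists_boundary_dart {s | T.IsBelow T.root s} (.refl _) ht
  have := (eq_and_isChild_of_adj hfst hsnd d.adj).2.depth_eq
  simp [depth] at this

/-- The function on the nodes of a rooted tree defined by recursion on the children: its value at
`t` is `F t L`, where `L` lists the values at the children of `t`. -/
def eval {R : Type*} [Fintype N] (T : OrdTree N) (F : N → List R → R) (t : N) : R :=
  F t ((T.children t).attach.map fun c => T.eval F c.1)
termination_by Fintype.card N - T.graph.dist T.root t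
decreasing_by
  have hcard : T.graph.dist T.root c.1 < Fintype.card N := T.dist_lt_card c.1
  have hdist : T.graph.dist T.root c.1 = T.graph.dist T.root t + 1 := T.dist_child t c.1 c.2
  omega

theorem induction [Finite N] (T : OrdTree N) {C : N → Prop}
    (h : ∀ t, (∀ c ∈ T.children t, C c) → C t) (t : N) : C t := by
  have := Fintype.ofFinite N
  induction hn : Fintype.card N - T.depth t using Nat.strong_induction_on generalizing t with
  | _ n ih =>
    refine h t fun c hc => ih _ ?_ c rfl
    have hcard : T.depth c < Fintype.card N := T.dist_lt_card c
    have hdepth := IsChild.depth_eq hc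
    omega

variable [Fintype N]

theorem postOrder_eq (T : OrdTree N) (t : N) :
    T.postOrder t = (T.children t).flatMap T.postOrder ++ [t] := by
  rw [postOrder]
  congr 1
  exact List.flatMap_subtype (fun _ _ => rfl) |>.trans (by rw [List.unattach_attach])

theorem mem_postOrder : s ∈ T.postOrder t ↔ T.IsBelow t s := by
  induction t using T.induction with
  | h t ih =>
    rw [postOrder_eq, List.mem_append, List.mem_flatMap, List.mem_singleton, or_comm, isBelow_iff]
    exact or_congr_right (exists_congr fun c => and_congr_right fun hc => ih c hc)

theorem eval_eq {R : Type*} (T : OrdTree N) (F : N → List R → R) (t : N) :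
    T.eval F t = F t ((T.children t).map (T.eval F)) := by
  rw [eval]
  congr 1
  exact List.map_subtype (fun _ _ => rfl) |>.trans (by rw [List.unattach_attach])

end OrdTree

theorem foldl_flatMap_apply_eq {ι κ R : Type*} {step : (κ → R) → κ → κ → R} {g : κ → R}
    {f : ι → List κ} {l : List ι}
    (hf : ∀ i ∈ l, ∀ o s, s ∈ f i ∨ o s = g s → (f i).foldl step o s = g s) (o : κ → R) (s : κ)
    (hs : s ∈ l.flatMap f ∨ o s = g s) : (l.flatMap f).foldl step o s = g s := by
  induction l generalizing o with
  | nil => simpa using hs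
  | cons i l ih =>
    rw [List.flatMap_cons, List.foldl_append]
    refine ih (fun j hj => hf j (List.mem_cons_of_mem i hj)) _ ?_
    rw [List.flatMap_cons, List.mem_append, or_right_comm] at hs
    exact hs.symm.imp_right (hf i List.mem_cons_self o s)

section DynamicProgramming

variable {N R : Type*} [Fintype N] [DecidableEq N]

theorem foldl_postOrder_eq_eval (T : OrdTree N) (F : N → List R → R) (t : N) (o : N → R) (s : N)
    (hs : s ∈ T.postOrder t ∨ o s = T.eval F s) :
    (T.postOrder t).foldl (fun o t => Function.update o t (F t ((T.children t).map o))) o s =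
      T.eval F s := by
  induction t using T.induction generalizing o s with
  | h t ih =>
    rw [T.postOrder_eq, List.mem_append, List.mem_singleton, or_right_comm] at hs
    rw [T.postOrder_eq, List.foldl_append, List.foldl_cons, List.foldl_nil]
    by_cases hst : s = t
    · subst hst
      rw [Function.update_self, T.eval_eq]
      refine congrArg (F s) (List.map_congr_left fun c hc => ?_)
      exact foldl_flatMap_apply_eq ih o c
        (Or.inl (List.mem_flatMap.2 ⟨c, hc, OrdTree.mem_postOrder.2 (.refl c)⟩))
    · rw [Function.update_of_ne hst]
      exact foldl_flatMap_apply_eq ih o s (hs.resolve_right hst)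

theorem dynProg_eq {α : Type*} [DecidableEq α]
    (A : N → Finset α → Program α → List (Finset R) → Finset R) (P : Program α) (T : OrdTree N)
    (χ : N → Finset α) (t : N) :
    dynProg A P T χ t = A t (χ t) (bagProgram P (χ t)) ((T.children t).map (dynProg A P T χ)) := by
  have heval : dynProg A P T χ = T.eval fun t L => A t (χ t) (bagProgram P (χ t)) L :=
    funext fun s => foldl_postOrder_eq_eval T _ T.root _ s
      (Or.inl (OrdTree.mem_postOrder.2 (T.isBelow_root s)))
  rw [heval, T.eval_eq]

theorem mem_below {T : OrdTree N} {t s : N} : s ∈ below T t ↔ T.IsBelow t s := by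
  rw [below, List.mem_toFinset, OrdTree.mem_postOrder]

end DynamicProgramming

/-! ### Tree decompositions -/

section TreeDecomposition

variable {α N : Type*} [DecidableEq α] {V : Finset α} {G : SimpleGraph α} {T : OrdTree N}
  {χ : N → Finset α} {c t x y : N} {v : α}

theorem IsTreeDecomposition.mem_bag_of_isChild (h : IsTreeDecomposition V G T χ)
    (hc : T.IsChild t c) (hx : T.IsBelow c x) (hy : ¬ T.IsBelow c y) (hvx : v ∈ χ x)
    (hvy : v ∈ χ y) : v ∈ χ c ∧ v ∈ χ t := by
  obtain ⟨w, hw, -⟩ := T.isTree_graph.1.exists_path_of_dist x y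
  obtain ⟨d, hd, hfst, hsnd⟩ := w.exists_boundary_dart {s | T.IsBelow c s} hx hy
  obtain ⟨hdc, hdt⟩ := OrdTree.eq_and_isChild_of_adj hfst hsnd d.adj
  have hv : ∀ s ∈ w.support, v ∈ χ s := fun s hs =>
    h.path x s y w hw hs (Finset.mem_inter.2 ⟨hvx, hvy⟩)
  exact ⟨hdc ▸ hv _ (w.dart_fst_mem_support_of_mem_darts hd),
    hdt.parent_unique hc ▸ hv _ (w.dart_snd_mem_support_of_mem_darts hd)⟩

theorem IsTreeDecomposition.exists_clique_subset_bag [Finite N] (h : IsTreeDecomposition V G T χ)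
    {A : Finset α} (hAV : A ⊆ V) (hA : G.IsClique (A : Set α)) : ∃ s, A ⊆ χ s := by
  -- Descend from the root: a vertex of `A` outside the bag of `t` forces all of `A` below the
  -- child of `t` that it lies below.
  have hdescend : ∀ t, (∀ v ∈ A, ∃ s, T.IsBelow t s ∧ v ∈ χ s) → ∃ s, A ⊆ χ s := by
    intro t
    induction t using T.induction with
    | h t ih =>
      intro hAt
      by_cases hAχ : A ⊆ χ t
      · exact ⟨t, hAχ⟩
      obtain ⟨v, hv, hvt⟩ := Finset.not_subset.1 hAχ
      obtain ⟨x, hx, hvx⟩ := hAt v hv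
      obtain rfl | ⟨c, hc, hcx⟩ := OrdTree.isBelow_iff.1 hx
      · exact absurd hvx hvt
      have hbelow : ∀ s, v ∈ χ s → T.IsBelow c s := fun s hs => by
        by_contra hcs
        exact hvt (h.mem_bag_of_isChild hc hcx hcs hvx hs).2
      refine ih c hc fun u hu => ?_
      rcases eq_or_ne u v with rfl | huv
      · exact ⟨x, hcx, hvx⟩
      · obtain ⟨s, hus, hvs⟩ := h.cover_edge u v (hA hu hv huv)
        exact ⟨s, hbelow s hvs, hus⟩
  exact hdescend T.root fun v hv =>
    (h.cover_vertex v (hAV hv)).imp fun s hs => ⟨T.isBelow_root s, hs⟩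

variable [Fintype N] [DecidableEq N]

theorem mem_atomsBelow : v ∈ atomsBelow T χ t ↔ ∃ s, T.IsBelow t s ∧ v ∈ χ s := by
  simp only [atomsBelow, Finset.mem_biUnion, mem_below]

theorem bag_subset_atomsBelow (T : OrdTree N) (χ : N → Finset α) (t : N) :
    χ t ⊆ atomsBelow T χ t := fun _ hv => mem_atomsBelow.2 ⟨t, .refl t, hv⟩

theorem IsTreeDecomposition.atomsBelow_root (h : IsTreeDecomposition V G T χ) :
    atomsBelow T χ T.root = V := by
  ext v
  rw [mem_atomsBelow]
  exact ⟨fun ⟨s, _, hv⟩ => h.bag_subset s hv,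
    fun hv => (h.cover_vertex v hv).imp fun s hs => ⟨T.isBelow_root s, hs⟩⟩

end TreeDecomposition

/-! ### Orderings -/

section Orderings

variable {α : Type*} [DecidableEq α] {σ : List α} {I A : Finset α} {a b : α}

theorem IsOrdering.mem_iff (h : IsOrdering σ I) : a ∈ σ ↔ a ∈ I := by
  rw [← h.2, List.mem_toFinset]

theorem isOrdering_iff : IsOrdering σ I ↔ σ.Nodup ∧ ∀ a, a ∈ σ ↔ a ∈ I :=
  and_congr_right fun _ => by simp only [Finset.ext_iff, List.mem_toFinset]

theorem IsOrdering.filter (h : IsOrdering σ I) (A : Finset α) :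
    IsOrdering (σ.filter (· ∈ A)) (I ∩ A) := by
  rw [isOrdering_iff] at h ⊢
  exact ⟨h.1.filter _, fun a => by simp [h.2]⟩

theorem IsOrdering.concat (h : IsOrdering σ I) (ha : a ∉ I) :
    IsOrdering (σ ++ [a]) (insert a I) := by
  rw [isOrdering_iff] at h ⊢
  exact ⟨List.concat_eq_append ▸ h.1.concat ((h.2 a).not.2 ha), fun b => by simp [h.2, or_comm]⟩

theorem Before.idxOf_lt (h : Before σ b a) (hσ : σ.Nodup) : σ.idxOf b < σ.idxOf a := by
  have hpw : σ.Pairwise fun x y => σ.idxOf x < σ.idxOf y :=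
    List.pairwise_iff_getElem.2 fun i j hi hj hij => by
      rwa [hσ.idxOf_getElem, hσ.idxOf_getElem]
  simpa using hpw.sublist h

theorem before_filter (ha : a ∈ A) (hb : b ∈ A) :
    Before (σ.filter (· ∈ A)) b a ↔ Before σ b a := by
  refine ⟨fun h => List.Sublist.trans h List.filter_sublist, fun h => ?_⟩
  simpa [Before, ha, hb] using List.Sublist.filter (· ∈ A) h

theorem exists_isOrdering_of_forall_ssubset {R : Finset α → α → Prop}
    (h : ∀ S, S ⊂ I → ∃ a ∈ I, a ∉ S ∧ R S a) :
    ∃ σ, IsOrdering σ I ∧ ∀ a ∈ I, ∃ S, R S a ∧ ∀ b ∈ S, Before σ b a := by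
  classical
  obtain ⟨S, hS⟩ := (I.powerset.filter fun S =>
    ∃ σ, IsOrdering σ S ∧ ∀ a ∈ S, ∃ S', R S' a ∧ ∀ b ∈ S', Before σ b a).exists_maximal
      ⟨∅, by simpa using ⟨[], by simp [IsOrdering]⟩⟩
  simp only [Finset.mem_filter, Finset.mem_powerset] at hS
  obtain ⟨⟨hSI, σ, hσ, hbefore⟩, hmax⟩ := hS
  obtain rfl | hSI := hSI.eq_or_ssubset
  · exact ⟨σ, hσ, hbefore⟩
  obtain ⟨a, haI, haS, hRa⟩ := h S hSI
  refine absurd (hmax ⟨Finset.insert_subset haI hSI.1, σ ++ [a], hσ.concat haS, fun b hb => ?_⟩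
    (Finset.subset_insert a S) (Finset.mem_insert_self a S)) haS
  obtain rfl | hb := Finset.mem_insert.1 hb
  · exact ⟨S, hRa, fun c hc =>
      (List.singleton_sublist.2 (hσ.mem_iff.2 hc)).append (List.Sublist.refl [b])⟩
  · exact (hbefore b hb).imp fun S' hS' =>
      ⟨hS'.1, fun c hc => (hS'.2 c hc).trans (List.sublist_append_left σ [a])⟩

end Orderings

/-! ### Directed cycles and initial components -/

section Digraphs

variable {α : Type*} {r : α → α → Prop} {a b : α}

theorem exists_isChain_of_transGen (h : Relation.TransGen r a b) :
    ∃ l : List α, List.IsChain r (a :: (l ++ [b])) := by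
  induction h with
  | single h => exact ⟨[], by simpa using h⟩
  | @tail b c _ hbc ih =>
    obtain ⟨l, hl⟩ := ih
    have hlc : List.IsChain r ((a :: l) ++ b :: [c]) :=
      List.isChain_split.2 ⟨by simpa using hl, by simpa using hbc⟩
    exact ⟨l ++ [b], by simpa using hlc⟩

theorem exists_cycle_of_transGen (hab : Relation.TransGen r a b) (hba : Relation.TransGen r b a) :
    ∃ c : Cycle α, c.Chain r ∧ a ∈ c ∧ b ∈ c := by
  obtain ⟨l₁, h₁⟩ := exists_isChain_of_transGen hab
  obtain ⟨l₂, h₂⟩ := exists_isChain_of_transGen hba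
  have hl : List.IsChain r ((a :: l₁) ++ b :: (l₂ ++ [a])) :=
    List.isChain_split.2 ⟨by simpa using h₁, h₂⟩
  refine ⟨((a :: (l₁ ++ b :: l₂) : List α) : Cycle α), ?_, by simp, by simp⟩
  rw [Cycle.chain_coe_cons]
  simpa using hl

theorem exists_initial_component {U : Finset α} (hU : U.Nonempty) :
    ∃ C ⊆ U, C.Nonempty ∧ (∀ x ∈ U, ∀ y ∈ C, r x y → x ∈ C) ∧
      ∀ x ∈ C, ∀ y ∈ C, Relation.ReflTransGen r x y := by
  classical
  let _ : Preorder α :=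
    { le := Relation.ReflTransGen r
      le_refl := fun _ => .refl
      le_trans := fun _ _ _ => .trans }
  obtain ⟨m, hmU, hmin⟩ := U.exists_minimal hU
  refine ⟨U.filter (· ≤ m), Finset.filter_subset _ _, ⟨m, by simpa using hmU⟩, ?_, ?_⟩
  · intro x hx y hy hxy
    exact Finset.mem_filter.2 ⟨hx, .head hxy (Finset.mem_filter.1 hy).2⟩
  · intro x hx y hy
    rw [Finset.mem_filter] at hx hy
    exact le_trans hx.2 (hmin hy.1 hy.2)

end Digraphs

/-! ### Answer sets -/

section Programs

variable {α : Type*} {P P₁ P₂ : Program α} {r : Rule α} {I J A S S' : Finset α}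
  {σ : List α} {a b : α}

theorem HeadCycleFree.eq_of_reflTransGen (hP : HeadCycleFree P) (hr : r ∈ P) (ha : a ∈ r.head)
    (hb : b ∈ r.head) (hab : Relation.ReflTransGen (DepArc P) a b)
    (hba : Relation.ReflTransGen (DepArc P) b a) : a = b := by
  by_contra hne
  rw [Relation.reflTransGen_iff_eq_or_transGen] at hab hba
  exact hP ⟨r, hr, a, ha, b, hb, hne, exists_cycle_of_transGen (hab.resolve_left (Ne.symm hne))
    (hba.resolve_left hne)⟩

variable [DecidableEq α]

theorem Rule.head_subset_atoms (r : Rule α) : r.head ⊆ r.atoms :=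
  Finset.subset_union_left.trans Finset.subset_union_left

theorem Rule.pos_subset_atoms (r : Rule α) : r.pos ⊆ r.atoms :=
  Finset.subset_union_right.trans Finset.subset_union_left

theorem Rule.neg_subset_atoms (r : Rule α) : r.neg ⊆ r.atoms := Finset.subset_union_right

theorem Rule.atoms_subset_atoms (hr : r ∈ P) : r.atoms ⊆ P.atoms :=
  Finset.subset_biUnion_of_mem Rule.atoms hr

theorem Rule.atoms_eq_empty_iff : r.atoms = ∅ ↔ r = Rule.empty := by
  cases r
  simp [Rule.atoms, Rule.empty]

theorem Rule.not_sat_empty (I : Finset α) : ¬ (Rule.empty : Rule α).Sat I := by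
  simp [Rule.Sat, Rule.empty]

theorem Rule.sat_iff :
    r.Sat I ↔ (r.pos ⊆ I → I ∩ r.neg = ∅ → (r.head ∩ I).Nonempty) := by
  rw [Rule.Sat, Finset.union_inter_distrib_right, Ne, Finset.union_eq_empty, Ne,
    Finset.sdiff_eq_empty_iff_subset, Finset.nonempty_iff_ne_empty, Finset.inter_comm I]
  tauto

theorem Rule.sat_inter (hr : r.atoms ⊆ A) : r.Sat (I ∩ A) ↔ r.Sat I := by
  rw [Rule.sat_iff, Rule.sat_iff, Finset.subset_inter_iff,
    and_iff_left (r.pos_subset_atoms.trans hr), Finset.inter_assoc,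
    Finset.inter_eq_right.2 (r.neg_subset_atoms.trans hr), Finset.inter_comm I A,
    ← Finset.inter_assoc, Finset.inter_eq_left.2 (r.head_subset_atoms.trans hr)]

theorem isModel_inter (hP : P.atoms ⊆ A) : IsModel (I ∩ A) P ↔ IsModel I P :=
  forall₂_congr fun _ hr => Rule.sat_inter ((Rule.atoms_subset_atoms hr).trans hP)

theorem isModel_union : IsModel I (P₁ ∪ P₂) ↔ IsModel I P₁ ∧ IsModel I P₂ := by
  simp only [IsModel, Finset.mem_union, or_imp, forall_and]

theorem isModel_reduct_iff :
    IsModel J (P.reduct I) ↔ ∀ r ∈ P, I ∩ r.neg = ∅ → r.pos ⊆ J → (r.head ∩ J).Nonempty := by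
  simp only [IsModel, Program.reduct, Finset.forall_mem_image, Finset.mem_filter, and_imp,
    Rule.sat_iff, Finset.inter_comm I]
  exact forall₃_congr fun r _ _ => by simp [Rule.dropNeg]

theorem isModel_reduct_self : IsModel I (P.reduct I) ↔ IsModel I P := by
  rw [isModel_reduct_iff]
  simp only [IsModel, Rule.sat_iff]
  exact forall₂_congr fun r _ => imp.swap

/-- The atom `a` is supported in the interpretation `I` by the set `S`: some rule of `P` whose
positive body lies in `S` and whose negative body is false in `I` has `a` as its only head atom
that is true in `I`. -/
def IsSupported (P : Program α) (I S : Finset α) (a : α) : Prop :=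
  ∃ r ∈ P, a ∈ r.head ∧ r.pos ⊆ S ∧ I ∩ r.neg = ∅ ∧ I ∩ (r.head \ {a}) = ∅

theorem IsSupported.mono (h : IsSupported P I S a) (hS : S ⊆ S') : IsSupported P I S' a :=
  let ⟨r, hr, har, hpos, hrest⟩ := h
  ⟨r, hr, har, hpos.trans hS, hrest⟩

theorem IsSupported.mem_atoms (h : IsSupported P I S a) : a ∈ P.atoms :=
  let ⟨r, hr, har, _⟩ := h
  Rule.atoms_subset_atoms hr (r.head_subset_atoms har)

theorem IsSupported.mem_of_isModel_reduct (h : IsSupported P I S a) (hJ : IsModel J (P.reduct I))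
    (hJI : J ⊆ I) (hSJ : S ⊆ J) : a ∈ J := by
  obtain ⟨r, hr, har, hpos, hneg, hhead⟩ := h
  obtain ⟨b, hb⟩ := isModel_reduct_iff.1 hJ r hr hneg (hpos.trans hSJ)
  obtain ⟨hbr, hbJ⟩ := Finset.mem_inter.1 hb
  obtain rfl : b = a := by
    by_contra hba
    have hmem : b ∈ I ∩ (r.head \ {a}) := by simp [hJI hbJ, hbr, hba]
    exact Finset.notMem_empty b (hhead ▸ hmem)
  exact hbJ

theorem isSupported_inter (hP : P.atoms ⊆ A) :
    IsSupported P (I ∩ A) (S ∩ A) a ↔ IsSupported P I S a := by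
  refine exists_congr fun r => and_congr_right fun hr => and_congr_right fun _ => ?_
  have hrA := (Rule.atoms_subset_atoms hr).trans hP
  rw [Finset.subset_inter_iff, and_iff_left (r.pos_subset_atoms.trans hrA), Finset.inter_assoc,
    Finset.inter_assoc, Finset.inter_eq_right.2 (r.neg_subset_atoms.trans hrA),
    Finset.inter_eq_right.2 (Finset.sdiff_subset.trans (r.head_subset_atoms.trans hrA))]

theorem mem_gatherProof :
    a ∈ gatherProof I σ P ↔ IsSupported P I (I.filter (Before σ · a)) a := by
  simp only [gatherProof, IsSupported, Finset.mem_biUnion, Finset.mem_filter, Finset.subset_iff]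
  exact exists_congr fun r => by grind

theorem gatherProof_union :
    gatherProof I σ (P₁ ∪ P₂) = gatherProof I σ P₁ ∪ gatherProof I σ P₂ :=
  Finset.union_biUnion

theorem gatherProof_subset_atoms (hP : P.atoms ⊆ A) : gatherProof I σ P ⊆ A :=
  fun _ ha => hP (mem_gatherProof.1 ha).mem_atoms

theorem gatherProof_subset (hI : IsModel I P) : gatherProof I σ P ⊆ I := fun _ ha =>
  (mem_gatherProof.1 ha).mem_of_isModel_reduct (isModel_reduct_self.2 hI) subset_rfl
    (Finset.filter_subset _ _)

theorem gatherProof_inter (hP : P.atoms ⊆ A) :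
    gatherProof (I ∩ A) (σ.filter (· ∈ A)) P = gatherProof I σ P := by
  ext a
  by_cases ha : a ∈ A
  · have hbefore : (I ∩ A).filter (Before (σ.filter (· ∈ A)) · a) =
        I.filter (Before σ · a) ∩ A := by
      ext b
      simp only [Finset.mem_filter, Finset.mem_inter]
      rw [and_right_comm, and_congr_left fun hb => and_congr_right' (before_filter ha hb)]
    rw [mem_gatherProof, mem_gatherProof, hbefore, isSupported_inter hP]
  · exact iff_of_false (fun h => ha (gatherProof_subset_atoms hP h))
      fun h => ha (gatherProof_subset_atoms hP h)

theorem proven_iff : Proven P I σ a ↔ a ∈ I ∧ a ∈ gatherProof I σ P := by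
  simp only [Proven, gatherProof, Finset.mem_biUnion, Finset.mem_filter]
  exact and_congr_right fun _ => exists_congr fun r => by tauto

theorem IsAnswerSet.isModel (hI : IsAnswerSet P I) : IsModel I P := isModel_reduct_self.1 hI.1

theorem IsAnswerSet.exists_rule (hI : IsAnswerSet P I) (hS : S ⊆ I) (hne : S.Nonempty) :
    ∃ r ∈ P, r.pos ⊆ I \ S ∧ I ∩ r.neg = ∅ ∧ (r.head ∩ I).Nonempty ∧ r.head ∩ I ⊆ S := by
  have hmin := hI.2 (I \ S) (Finset.sdiff_ssubset hS hne)
  rw [isModel_reduct_iff] at hmin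
  push Not at hmin
  obtain ⟨r, hr, hneg, hpos, hhead⟩ := hmin
  refine ⟨r, hr, hpos, hneg,
    isModel_reduct_iff.1 hI.1 r hr hneg (hpos.trans Finset.sdiff_subset), ?_⟩
  rwa [← Finset.inter_sdiff_assoc, Finset.sdiff_eq_empty_iff_subset] at hhead

theorem IsAnswerSet.subset_atoms (hI : IsAnswerSet P I) : I ⊆ P.atoms := by
  rw [← Finset.sdiff_eq_empty_iff_subset, ← Finset.not_nonempty_iff_eq_empty]
  intro hne
  obtain ⟨r, hr, -, -, ⟨a, ha⟩, hhead⟩ := hI.exists_rule Finset.sdiff_subset hne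
  exact (Finset.mem_sdiff.1 (hhead ha)).2
    (Rule.atoms_subset_atoms hr (r.head_subset_atoms (Finset.mem_inter.1 ha).1))

/- The part `C` of `I` that is removed is an initial strongly connected component of `I \ S`: by
minimality of `I` a rule supports an atom of `C` by `S`, and head-cycle-freeness makes that atom
the only true one in the head of the rule. -/
theorem IsAnswerSet.exists_isSupported (hI : IsAnswerSet P I) (hP : HeadCycleFree P) (hS : S ⊂ I) :
    ∃ a ∈ I, a ∉ S ∧ IsSupported P I S a := by
  obtain ⟨C, hC, hne, hinit, hconn⟩ :=
    exists_initial_component (r := DepArc P) (Finset.sdiff_nonempty.2 hS.2)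
  obtain ⟨r, hr, hpos, hneg, ⟨a, ha⟩, hhead⟩ :=
    hI.exists_rule (hC.trans Finset.sdiff_subset) hne
  have haC := hhead ha
  obtain ⟨har, -⟩ := Finset.mem_inter.1 ha
  obtain ⟨haI, haS⟩ := Finset.mem_sdiff.1 (hC haC)
  refine ⟨a, haI, haS, r, hr, har, fun b hb => ?_, hneg, ?_⟩
  · obtain ⟨hbI, hbC⟩ := Finset.mem_sdiff.1 (hpos hb)
    by_contra hbS
    exact hbC (hinit b (Finset.mem_sdiff.2 ⟨hbI, hbS⟩) a haC ⟨r, hr, hb, har⟩)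
  · rw [Finset.eq_empty_iff_forall_notMem]
    intro b hb
    simp only [Finset.mem_inter, Finset.mem_sdiff, Finset.mem_singleton] at hb
    obtain ⟨hbI, hbr, hba⟩ := hb
    have hbC := hhead (Finset.mem_inter.2 ⟨hbr, hbI⟩)
    exact hba (hP.eq_of_reflTransGen hr hbr har (hconn b hbC a haC) (hconn a haC b hbC))

theorem IsAnswerSet.exists_isOrdering (hI : IsAnswerSet P I) (hP : HeadCycleFree P) :
    ∃ σ, IsOrdering σ I ∧ I ⊆ gatherProof I σ P := by
  have hext : ∀ S, S ⊂ I → ∃ a ∈ I, a ∉ S ∧ S ⊆ I ∧ IsSupported P I S a := fun S hS =>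
    (hI.exists_isSupported hP hS).imp fun _ h => ⟨h.1, h.2.1, hS.1, h.2.2⟩
  obtain ⟨σ, hσ, hsupp⟩ := exists_isOrdering_of_forall_ssubset hext
  refine ⟨σ, hσ, fun a ha => ?_⟩
  obtain ⟨S, ⟨hSI, hS⟩, hbefore⟩ := hsupp a ha
  exact mem_gatherProof.2
    (hS.mono fun b hb => Finset.mem_filter.2 ⟨hSI hb, hbefore b hb⟩)

theorem isAnswerSet_of_subset_gatherProof (hI : IsModel I P) (hσ : σ.Nodup)
    (hproof : I ⊆ gatherProof I σ P) : IsAnswerSet P I := by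
  refine ⟨isModel_reduct_self.2 hI, fun J hJ hJm => hJ.2 fun a ha => ?_⟩
  induction hn : σ.idxOf a using Nat.strong_induction_on generalizing a with
  | _ n ih =>
    refine (mem_gatherProof.1 (hproof ha)).mem_of_isModel_reduct hJm hJ.1 fun b hb => ?_
    obtain ⟨hbI, hba⟩ := Finset.mem_filter.1 hb
    exact ih _ (hn ▸ hba.idxOf_lt hσ) b hbI rfl

theorem HeadCycleFree.isAnswerSet_iff (hP : HeadCycleFree P) :
    IsAnswerSet P I ↔ I ⊆ P.atoms ∧ IsModel I P ∧ ∃ σ, IsOrdering σ I ∧ I ⊆ gatherProof I σ P :=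
  ⟨fun hI => ⟨hI.subset_atoms, hI.isModel, hI.exists_isOrdering hP⟩,
    fun ⟨_, hI, _, hσ, hproof⟩ => isAnswerSet_of_subset_gatherProof hI hσ.1 hproof⟩

end Programs

/-! ### Merging orderings -/

section Merging

variable {α : Type*}

theorem exists_filter_eq_and_filter_eq {p q : α → Bool} {σ₁ σ₂ : List α} (h₁ : ∀ a ∈ σ₁, p a)
    (h₂ : ∀ a ∈ σ₂, q a) (h : σ₁.filter q = σ₂.filter p) :
    ∃ σ : List α, (∀ a ∈ σ, p a ∨ q a) ∧ σ.filter p = σ₁ ∧ σ.filter q = σ₂ := by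
  induction σ₂ generalizing σ₁ with
  | nil => exact ⟨σ₁, fun a ha => Or.inl (h₁ a ha), List.filter_eq_self.2 h₁, by simpa using h⟩
  | cons y σ₂ ih =>
    obtain ⟨hy, h₂⟩ := List.forall_mem_cons.1 h₂
    by_cases hpy : p y
    · rw [List.filter_cons_of_pos hpy, List.filter_eq_cons_iff] at h
      obtain ⟨l, σ₁, rfl, hl, -, h⟩ := h
      obtain ⟨hpl, hpσ₁⟩ := List.forall_mem_append.1 h₁
      obtain ⟨σ, hpq, rfl, rfl⟩ := ih (List.forall_mem_cons.1 hpσ₁).2 h₂ h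
      refine ⟨l ++ y :: σ, ?_, ?_, ?_⟩
      · rw [List.forall_mem_append, List.forall_mem_cons]
        exact ⟨fun a ha => Or.inl (hpl a ha), Or.inl hpy, hpq⟩
      · rw [List.filter_append, List.filter_eq_self.2 hpl, List.filter_cons_of_pos hpy]
      · rw [List.filter_append, List.filter_eq_nil_iff.2 hl, List.filter_cons_of_pos hy,
          List.nil_append]
    · rw [List.filter_cons_of_neg hpy] at h
      obtain ⟨σ, hpq, rfl, rfl⟩ := ih h₁ h₂ h
      exact ⟨y :: σ, List.forall_mem_cons.2 ⟨Or.inr hy, hpq⟩, List.filter_cons_of_neg hpy,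
        List.filter_cons_of_pos hy⟩

variable [DecidableEq α] {A A' A₁ A₂ I I₁ I₂ : Finset α} {σ σ₁ σ₂ : List α}

theorem filter_filter_mem_of_subset (h : A' ⊆ A) :
    (σ.filter (· ∈ A)).filter (· ∈ A') = σ.filter (· ∈ A') := by
  rw [List.filter_filter]
  congr! 2 with a
  simpa using @h a

theorem IsOrdering.filter_congr (h : IsOrdering σ I) (hI : I ∩ A = I ∩ A') :
    σ.filter (· ∈ A) = σ.filter (· ∈ A') :=
  List.filter_congr fun a ha => by
    simpa [h.mem_iff.1 ha] using Finset.ext_iff.1 hI a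

theorem IsOrdering.filter_eq_self (h : IsOrdering σ I) (hI : I ⊆ A) : σ.filter (· ∈ A) = σ :=
  List.filter_eq_self.2 fun _ ha => by simpa using hI (h.mem_iff.1 ha)

theorem IsOrdering.inter_eq_of_filter_eq (h : IsOrdering σ I) (h₁ : IsOrdering σ₁ I₁)
    (hσ : σ.filter (· ∈ A) = σ₁) : I ∩ A = I₁ := by
  rw [← h₁.2, ← hσ, (h.filter A).2]

theorem IsOrdering.exists_union (h₁ : IsOrdering σ₁ I₁) (h₂ : IsOrdering σ₂ I₂) (hI₁ : I₁ ⊆ A₁)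
    (hI₂ : I₂ ⊆ A₂) (h : σ₁.filter (· ∈ A₂) = σ₂.filter (· ∈ A₁)) :
    ∃ σ, IsOrdering σ (I₁ ∪ I₂) ∧ σ.filter (· ∈ A₁) = σ₁ ∧ σ.filter (· ∈ A₂) = σ₂ := by
  obtain ⟨σ, hσ, hσ₁, hσ₂⟩ := exists_filter_eq_and_filter_eq
    (fun a ha => by simpa using hI₁ (h₁.mem_iff.1 ha))
    (fun a ha => by simpa using hI₂ (h₂.mem_iff.1 ha)) h
  simp only [decide_eq_true_eq] at hσ
  refine ⟨σ, isOrdering_iff.2 ⟨List.nodup_iff_count_le_one.2 fun a => ?_, fun a => ?_⟩, hσ₁, hσ₂⟩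
  · by_cases ha : a ∈ σ
    · obtain hA | hA := hσ a ha
      · rw [← List.count_filter (p := (· ∈ A₁)) (by simpa using hA), hσ₁]
        exact List.nodup_iff_count_le_one.1 h₁.1 a
      · rw [← List.count_filter (p := (· ∈ A₂)) (by simpa using hA), hσ₂]
        exact List.nodup_iff_count_le_one.1 h₂.1 a
    · simp [List.count_eq_zero_of_not_mem ha]
  · rw [Finset.mem_union, ← h₁.mem_iff, ← h₂.mem_iff, ← hσ₁, ← hσ₂]
    simp only [List.mem_filter, decide_eq_true_eq, ← and_or_left]
    exact (and_iff_left_of_imp (hσ a)).symm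

end Merging

/-! ### Partial solutions and their traces -/

section PartialSolutions

variable {α : Type*} [DecidableEq α] {P P₁ P₂ : Program α} {A A₁ A₂ B B₁ I I₁ I₂ : Finset α}
  {σ σ₁ σ₂ : List α} {a : α} {u : Row α}

/-- Partial solutions with interface `B`: a model `I ⊆ A` of `P` together with an ordering `σ` of
`I` that proves every atom of `I` outside `B`. The atoms in `B` may still be proven by rules that
do not belong to `P`. -/
structure IsSolution (P : Program α) (A B I : Finset α) (σ : List α) : Prop where
  subset : I ⊆ A
  ordering : IsOrdering σ I
  model : IsModel I P
  proven : I \ B ⊆ gatherProof I σ P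

/-- The row that the algorithm stores for `(I, σ)` in a bag `B` when the program `P` has been
processed. -/
def trace (P : Program α) (B I : Finset α) (σ : List α) : Row α :=
  (I ∩ B, gatherProof I σ P ∩ B, σ.filter (· ∈ B))

/-- The row `u` results from combining a row `s₁` of a bag `B₁` with a row `s₂` of a larger bag
whose restriction to `B₁` agrees with `s₁`. This covers both join nodes and introduce nodes; in the
latter case `s₂` is the contribution of the bag-program. -/
structure Glues (B₁ : Finset α) (s₁ s₂ u : Row α) : Prop where
  interpretation : s₂.1 ∩ B₁ = s₁.1
  ordering : s₂.2.2.filter (· ∈ B₁) = s₁.2.2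
  eq : u = (s₂.1, s₁.2.1 ∪ s₂.2.1, s₂.2.2)

theorem trace_inter (hP : P.atoms ⊆ A) (hB : B ⊆ A) :
    trace P B (I ∩ A) (σ.filter (· ∈ A)) = trace P B I σ := by
  rw [trace, trace, gatherProof_inter hP, Finset.inter_assoc, Finset.inter_eq_right.2 hB,
    filter_filter_mem_of_subset hB]

theorem glues_trace (hP₁ : P₁.atoms ⊆ A₁) (hB₁ : B₁ ⊆ B) (hAB : A₁ ∩ B ⊆ B₁) :
    Glues B₁ (trace P₁ B₁ I σ) (trace P₂ B I σ) (trace (P₁ ∪ P₂) B I σ) where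
  interpretation := by simp only [trace, Finset.inter_assoc, Finset.inter_eq_right.2 hB₁]
  ordering := filter_filter_mem_of_subset hB₁
  eq := by
    have hB : gatherProof I σ P₁ ∩ B = gatherProof I σ P₁ ∩ B₁ :=
      (Finset.inter_subset_inter_left hB₁).antisymm' <| Finset.subset_inter
        Finset.inter_subset_left
        ((Finset.inter_subset_inter_right (gatherProof_subset_atoms hP₁)).trans hAB)
    simp only [trace, gatherProof_union, Finset.union_inter_distrib_right, hB]

theorem IsSolution.of_union (h : IsSolution (P₁ ∪ P₂) (A₁ ∪ A₂) B I σ) (hP₁ : P₁.atoms ⊆ A₁)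
    (hP₂ : P₂.atoms ⊆ A₂) (hA : A₁ ∩ A₂ ⊆ B₁) (hB : A₁ ∩ B ⊆ B₁) :
    IsSolution P₁ A₁ B₁ (I ∩ A₁) (σ.filter (· ∈ A₁)) where
  subset := Finset.inter_subset_right
  ordering := h.ordering.filter A₁
  model := (isModel_inter hP₁).2 (isModel_union.1 h.model).1
  proven a ha := by
    obtain ⟨⟨haI, haA₁⟩, haB₁⟩ := by simpa only [Finset.mem_sdiff, Finset.mem_inter] using ha
    have haA₂ : a ∉ A₂ := fun haA₂ => haB₁ (hA (Finset.mem_inter.2 ⟨haA₁, haA₂⟩))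
    have haB : a ∉ B := fun haB => haB₁ (hB (Finset.mem_inter.2 ⟨haA₁, haB⟩))
    have hproof := h.proven (Finset.mem_sdiff.2 ⟨haI, haB⟩)
    rw [gatherProof_union, Finset.mem_union] at hproof
    rw [gatherProof_inter hP₁]
    exact hproof.resolve_right fun hproof => haA₂ (gatherProof_subset_atoms hP₂ hproof)

theorem isSolution_union_iff (hP₁ : P₁.atoms ⊆ A₁) (hP₂ : P₂.atoms ⊆ A₂) (hA : A₁ ∩ A₂ ⊆ B₁)
    (hB₁ : B₁ ⊆ B) (hB : B ⊆ A₂) (hI : I ⊆ A₁ ∪ A₂) (hσ : IsOrdering σ I) :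
    IsSolution (P₁ ∪ P₂) (A₁ ∪ A₂) B I σ ↔
      IsSolution P₁ A₁ B₁ (I ∩ A₁) (σ.filter (· ∈ A₁)) ∧
        IsSolution P₂ A₂ B (I ∩ A₂) (σ.filter (· ∈ A₂)) := by
  refine ⟨fun h => ⟨h.of_union hP₁ hP₂ hA ((Finset.inter_subset_inter_left hB).trans hA), ?_⟩,
    fun ⟨h₁, h₂⟩ => ⟨hI, hσ, ?_, fun a ha => ?_⟩⟩
  · rw [Finset.union_comm P₁, Finset.union_comm A₁] at h
    exact h.of_union hP₂ hP₁ (Finset.inter_comm A₂ A₁ ▸ hA.trans hB₁) Finset.inter_subset_right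
  · exact isModel_union.2 ⟨(isModel_inter hP₁).1 h₁.model, (isModel_inter hP₂).1 h₂.model⟩
  · have hproof₁ := h₁.proven
    have hproof₂ := h₂.proven
    rw [gatherProof_inter hP₁] at hproof₁
    rw [gatherProof_inter hP₂] at hproof₂
    rw [gatherProof_union, Finset.mem_union]
    obtain ⟨haI, haB⟩ := Finset.mem_sdiff.1 ha
    refine (Finset.mem_union.1 (hI haI)).imp (fun haA₁ => hproof₁ ?_) fun haA₂ => hproof₂ ?_
    · exact Finset.mem_sdiff.2 ⟨Finset.mem_inter.2 ⟨haI, haA₁⟩, fun haB₁ => haB (hB₁ haB₁)⟩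
    · exact Finset.mem_sdiff.2 ⟨Finset.mem_inter.2 ⟨haI, haA₂⟩, haB⟩

theorem IsSolution.exists_union (h₁ : IsSolution P₁ A₁ B₁ I₁ σ₁) (h₂ : IsSolution P₂ A₂ B I₂ σ₂)
    (hP₁ : P₁.atoms ⊆ A₁) (hP₂ : P₂.atoms ⊆ A₂) (hA : A₁ ∩ A₂ = B₁) (hB₁ : B₁ ⊆ B) (hB : B ⊆ A₂)
    (hglues : Glues B₁ (trace P₁ B₁ I₁ σ₁) (trace P₂ B I₂ σ₂) u) :
    ∃ σ, IsSolution (P₁ ∪ P₂) (A₁ ∪ A₂) B (I₁ ∪ I₂) σ ∧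
      u = trace (P₁ ∪ P₂) B (I₁ ∪ I₂) σ := by
  have hσ₁₂ : σ₁.filter (· ∈ A₂) = σ₂.filter (· ∈ A₁) := by
    calc σ₁.filter (· ∈ A₂) = σ₁.filter (· ∈ B₁) := h₁.ordering.filter_congr (by
          rw [← hA, ← Finset.inter_assoc, Finset.inter_eq_left.2 h₁.subset])
      _ = (σ₂.filter (· ∈ B)).filter (· ∈ B₁) := hglues.ordering.symm
      _ = σ₂.filter (· ∈ B₁) := filter_filter_mem_of_subset hB₁
      _ = σ₂.filter (· ∈ A₁) := h₂.ordering.filter_congr (by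
          rw [← hA, Finset.inter_comm A₁, ← Finset.inter_assoc, Finset.inter_eq_left.2 h₂.subset])
  obtain ⟨σ, hσ, rfl, rfl⟩ := h₁.ordering.exists_union h₂.ordering h₁.subset h₂.subset hσ₁₂
  have hI := Finset.union_subset_union h₁.subset h₂.subset
  have hI₁ := hσ.inter_eq_of_filter_eq h₁.ordering rfl
  have hI₂ := hσ.inter_eq_of_filter_eq h₂.ordering rfl
  generalize I₁ ∪ I₂ = I at hσ hI hI₁ hI₂ ⊢
  subst hI₁ hI₂
  rw [trace_inter hP₁ (hA ▸ Finset.inter_subset_left), trace_inter hP₂ hB] at hglues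
  refine ⟨σ, (isSolution_union_iff hP₁ hP₂ hA.subset hB₁ hB hI hσ).2 ⟨h₁, h₂⟩, ?_⟩
  rw [hglues.eq]
  exact (glues_trace hP₁ hB₁ ((Finset.inter_subset_inter_left hB).trans hA.subset)).eq.symm

theorem exists_isSolution_union_iff (hP₁ : P₁.atoms ⊆ A₁) (hP₂ : P₂.atoms ⊆ A₂)
    (hA : A₁ ∩ A₂ = B₁) (hB₁ : B₁ ⊆ B) (hB : B ⊆ A₂) :
    (∃ σ, IsSolution (P₁ ∪ P₂) (A₁ ∪ A₂) B I σ ∧ u = trace (P₁ ∪ P₂) B I σ) ↔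
      ∃ I₁ σ₁ I₂ σ₂, IsSolution P₁ A₁ B₁ I₁ σ₁ ∧ IsSolution P₂ A₂ B I₂ σ₂ ∧
        Glues B₁ (trace P₁ B₁ I₁ σ₁) (trace P₂ B I₂ σ₂) u ∧ I = I₁ ∪ I₂ := by
  constructor
  · rintro ⟨σ, h, rfl⟩
    obtain ⟨h₁, h₂⟩ := (isSolution_union_iff hP₁ hP₂ hA.subset hB₁ hB h.subset h.ordering).1 h
    refine ⟨_, _, _, _, h₁, h₂, ?_, ?_⟩
    · rw [trace_inter hP₁ (hA ▸ Finset.inter_subset_left), trace_inter hP₂ hB]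
      exact glues_trace hP₁ hB₁ ((Finset.inter_subset_inter_left hB).trans hA.subset)
    · rw [← Finset.inter_union_distrib_left, Finset.inter_eq_left.2 h.subset]
  · rintro ⟨I₁, σ₁, I₂, σ₂, h₁, h₂, hglues, rfl⟩
    exact h₁.exists_union h₂ hP₁ hP₂ hA hB₁ hB hglues

theorem trace_insert (hσ : σ.Nodup) (ha : a ∉ B) :
    trace P B I σ = ((trace P (insert a B) I σ).1.erase a, (trace P (insert a B) I σ).2.1.erase a,
      (trace P (insert a B) I σ).2.2.erase a) := by
  have hfilter : (σ.filter (· ∈ insert a B)).erase a = σ.filter (· ∈ B) := by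
    rw [(hσ.filter _).erase_eq_filter, List.filter_filter]
    congr! 2 with b
    rcases eq_or_ne b a with rfl | hba
    · simp [ha]
    · simp [hba]
  simp only [trace, hfilter, ← Finset.inter_erase, Finset.erase_insert ha]

theorem isSolution_iff_insert (ha : a ∉ B) :
    IsSolution P A B I σ ↔
      IsSolution P A (insert a B) I σ ∧ (a ∈ gatherProof I σ P ∨ a ∉ I) := by
  have hproven : I \ B ⊆ gatherProof I σ P ↔
      I \ insert a B ⊆ gatherProof I σ P ∧ (a ∈ gatherProof I σ P ∨ a ∉ I) := by
    simp only [Finset.subset_iff, Finset.mem_sdiff, Finset.mem_insert]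
    grind
  exact ⟨fun h => ⟨⟨h.subset, h.ordering, h.model, (hproven.1 h.proven).1⟩,
    (hproven.1 h.proven).2⟩, fun ⟨h, hmem⟩ => ⟨h.subset, h.ordering, h.model,
    hproven.2 ⟨h.proven, hmem⟩⟩⟩

end PartialSolutions

/-! ### Rows of the tables -/

section Rows

theorem insertIdx_length_append {α : Type*} (l l' : List α) (a : α) :
    (l ++ l').insertIdx l.length a = l ++ a :: l' := by
  induction l with
  | nil => rfl
  | cons b l ih => rw [List.cons_append, List.length_cons, List.insertIdx_succ_cons, ih,
      List.cons_append]

variable {α : Type*} [DecidableEq α] {P : Program α} {A B B₁ I J : Finset α} {σ ρ : List α} {a : α}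
  {s s₁ s₂ u : Row α}

/-- Well-formed rows of a bag `B`: the interpretation lies in `B`, the proven atoms are true, and
the sequence is an ordering of the true atoms. -/
def IsRowOf (B : Finset α) (u : Row α) : Prop :=
  u.1 ⊆ B ∧ u.2.1 ⊆ u.1 ∧ IsOrdering u.2.2 u.1

theorem glues_iff : Glues B s₁ s₂ u ↔ s₂.1 ∩ B = s₁.1 ∧ s₂.2.2.filter (· ∈ B) = s₁.2.2 ∧
    u = (s₂.1, s₁.2.1 ∪ s₂.2.1, s₂.2.2) :=
  ⟨fun h => ⟨h.interpretation, h.ordering, h.eq⟩, fun ⟨hI, hσ, hu⟩ => ⟨hI, hσ, hu⟩⟩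

theorem IsOrdering.erase (h : IsOrdering σ I) (a : α) : IsOrdering (σ.erase a) (I.erase a) :=
  isOrdering_iff.2 ⟨h.1.erase a, fun b => by rw [h.1.mem_erase_iff, Finset.mem_erase, h.mem_iff]⟩

theorem isOrdering_empty_iff : IsOrdering σ ∅ ↔ σ = [] := by
  simp only [IsOrdering, List.toFinset_eq_empty_iff]
  exact and_iff_right_of_imp fun h => h ▸ List.nodup_nil

theorem isRowOf_empty_iff : IsRowOf ∅ u ↔ u = (∅, ∅, []) := by
  obtain ⟨I, Q, σ⟩ := u
  simp only [IsRowOf, Finset.subset_empty, Prod.mk.injEq]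
  constructor
  · rintro ⟨rfl, hQ, hσ⟩
    exact ⟨rfl, Finset.subset_empty.1 hQ, isOrdering_empty_iff.1 hσ⟩
  · rintro ⟨rfl, rfl, rfl⟩
    exact ⟨rfl, subset_rfl, isOrdering_empty_iff.2 rfl⟩

theorem IsSolution.isRowOf_trace (h : IsSolution P A B₁ I σ) : IsRowOf B (trace P B I σ) :=
  ⟨Finset.inter_subset_right, Finset.inter_subset_inter_right (gatherProof_subset h.model),
    h.ordering.filter B⟩

theorem Glues.isRowOf (h : Glues B₁ s₁ s₂ u) (h₁ : IsRowOf B₁ s₁) (h₂ : IsRowOf B s₂) :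
    IsRowOf B u := by
  obtain ⟨hs, -, rfl⟩ := h
  refine ⟨h₂.1, Finset.union_subset (h₁.2.1.trans ?_) h₂.2.1, h₂.2.2⟩
  exact hs ▸ Finset.inter_subset_left

theorem IsRowOf.erase (h : IsRowOf (insert a B) u) :
    IsRowOf B (u.1.erase a, u.2.1.erase a, u.2.2.erase a) :=
  ⟨Finset.subset_insert_iff.1 h.1, Finset.erase_subset_erase a h.2.1, h.2.2.erase a⟩

theorem mem_possOrd_singleton (ha : a ∉ σ) : ρ ∈ possOrd σ {a} ↔ a ∈ ρ ∧ ρ.erase a = σ := by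
  simp only [possOrd, Finset.singleton_ne_empty, if_false, Finset.empty_union,
    Finset.singleton_biUnion, Finset.mem_image, Finset.mem_range, Nat.lt_succ_iff]
  constructor
  · rintro ⟨i, hi, rfl⟩
    obtain ⟨l, l', rfl, rfl⟩ : ∃ l l', σ = l ++ l' ∧ i = l.length :=
      ⟨_, _, (List.take_append_drop i σ).symm, (List.length_take_of_le hi).symm⟩
    have hal : a ∉ l := fun h => ha (List.mem_append_left l' h)
    rw [insertIdx_length_append, List.erase_append_right _ hal, List.erase_cons_head]
    exact ⟨by simp, rfl⟩
  · rintro ⟨haρ, rfl⟩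
    obtain ⟨l, l', -, rfl, herase⟩ := List.exists_erase_eq haρ
    rw [herase]
    exact ⟨l.length, by simp, insertIdx_length_append l l' a⟩

theorem mem_possOrd_inter (ha : a ∉ σ) :
    ρ ∈ possOrd σ ({a} ∩ J) ↔ (a ∈ ρ ↔ a ∈ J) ∧ ρ.erase a = σ := by
  by_cases haJ : a ∈ J
  · rw [Finset.singleton_inter_of_mem haJ, mem_possOrd_singleton ha, iff_true_right haJ]
  · rw [Finset.singleton_inter_of_notMem haJ, iff_false_right haJ]
    constructor
    · intro h
      obtain rfl : ρ = σ := by simpa [possOrd] using h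
      exact ⟨ha, List.erase_of_not_mem ha⟩
    · rintro ⟨haρ, rfl⟩
      simp [possOrd, List.erase_of_not_mem haρ]

theorem IsOrdering.filter_eq_erase (h : IsOrdering ρ J) (hJ : J ⊆ insert a B) (ha : a ∉ B) :
    ρ.filter (· ∈ B) = ρ.erase a := by
  rw [h.1.erase_eq_filter]
  refine List.filter_congr fun b hb => ?_
  rcases eq_or_ne b a with rfl | hba
  · simp [ha]
  · simp [hba, (Finset.mem_insert.1 (hJ (h.mem_iff.1 hb))).resolve_left hba]

theorem mem_possOrd_inter_iff (ha : a ∉ B) (hI : I ⊆ B) (hσ : IsOrdering σ I) :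
    (J = I ∨ J = insert a I) ∧ ρ ∈ possOrd σ ({a} ∩ J) ↔
      J ⊆ insert a B ∧ IsOrdering ρ J ∧ ρ.filter (· ∈ B) = σ := by
  have haI : a ∉ I := fun h => ha (hI h)
  have haσ : a ∉ σ := fun h => haI (hσ.mem_iff.1 h)
  rw [mem_possOrd_inter haσ]
  constructor
  · rintro ⟨hJ, haρ, rfl⟩
    have hJI : J.erase a = I := by
      rcases hJ with rfl | rfl
      exacts [Finset.erase_eq_of_notMem haI, Finset.erase_insert haI]
    have hJB : J ⊆ insert a B := Finset.subset_insert_iff.2 (hJI ▸ hI)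
    have hρ : IsOrdering ρ J := by
      rw [isOrdering_iff] at hσ ⊢
      by_cases hmem : a ∈ ρ
      · obtain ⟨hnd, hmemI⟩ := hσ
        refine ⟨(List.perm_cons_erase hmem).nodup_iff.2 (List.nodup_cons.2 ⟨haσ, hnd⟩), fun b => ?_⟩
        rw [(List.perm_cons_erase hmem).mem_iff, List.mem_cons, hmemI, ← hJI, Finset.mem_erase]
        grind
      · rwa [List.erase_of_not_mem hmem, ← hJI,
          Finset.erase_eq_of_notMem (mt haρ.2 hmem)] at hσ
    exact ⟨hJB, hρ, hρ.filter_eq_erase hJB ha⟩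
  · rintro ⟨hJ, hρ, rfl⟩
    rw [hρ.filter_eq_erase hJ ha] at hσ
    have hJI : J.erase a = I := (hρ.erase a).2.symm.trans hσ.2
    refine ⟨?_, hρ.mem_iff, (hρ.filter_eq_erase hJ ha).symm⟩
    by_cases haJ : a ∈ J
    · exact Or.inr (hJI ▸ (Finset.insert_erase haJ).symm)
    · exact Or.inl (hJI ▸ (Finset.erase_eq_of_notMem haJ).symm)

theorem isSolution_self_iff : IsSolution P B B I σ ↔ I ⊆ B ∧ IsOrdering σ I ∧ IsModel I P :=
  ⟨fun h => ⟨h.subset, h.ordering, h.model⟩, fun ⟨hI, hσ, hmodel⟩ =>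
    ⟨hI, hσ, hmodel, by simp [Finset.sdiff_eq_empty_iff_subset.2 hI]⟩⟩

theorem IsSolution.trace_eq (h : IsSolution P B B I σ) :
    trace P B I σ = (I, gatherProof I σ P, σ) := by
  rw [trace, Finset.inter_eq_left.2 h.subset, h.ordering.filter_eq_self h.subset,
    Finset.inter_eq_left.2 ((gatherProof_subset h.model).trans h.subset)]

theorem exists_isSolution_glues_iff (ha : a ∉ B) (hs : IsRowOf B s) :
    (∃ J ρ, IsSolution P (insert a B) (insert a B) J ρ ∧ Glues B s (trace P (insert a B) J ρ) u) ↔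
      ∃ J, ((J = s.1 ∨ J = insert a s.1) ∧ IsModel J P) ∧
        ∃ ρ ∈ possOrd s.2.2 ({a} ∩ J), (J, s.2.1 ∪ gatherProof J ρ P, ρ) = u := by
  have hposs : ∀ {J ρ}, _ ↔ _ := fun {J ρ} =>
    mem_possOrd_inter_iff (J := J) (ρ := ρ) ha hs.1 hs.2.2
  constructor
  · rintro ⟨J, ρ, h, hglues⟩
    rw [h.trace_eq] at hglues
    obtain ⟨hJ, hρ⟩ := hposs.2 ⟨h.subset, h.ordering, hglues.ordering⟩
    exact ⟨J, ⟨hJ, h.model⟩, ρ, hρ, hglues.eq.symm⟩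
  · rintro ⟨J, ⟨hJ, hmodel⟩, ρ, hρ, rfl⟩
    obtain ⟨hJB, hordering, hfilter⟩ := hposs.1 ⟨hJ, hρ⟩
    have h : IsSolution P (insert a B) (insert a B) J ρ :=
      isSolution_self_iff.2 ⟨hJB, hordering, hmodel⟩
    refine ⟨J, ρ, h, ?_⟩
    rw [h.trace_eq]
    exact ⟨hordering.inter_eq_of_filter_eq hs.2.2 hfilter, hfilter, rfl⟩

end Rows

/-! ### Origins and extensions -/

section Origins

variable {α N : Type*} [DecidableEq α] {P : Program α} {T : OrdTree N} {χ : N → Finset α}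
  {t c c₁ c₂ : N} {a : α} {s s₁ s₂ u : Row α}

/-- The shape of a nice tree decomposition at the node `t`, with the introduced or removed atom
made explicit. -/
inductive NodeShape (T : OrdTree N) (χ : N → Finset α) (t : N) : Prop
  | leaf (children : T.children t = []) (type : nodeType T χ t = some .leaf) (bag : χ t = ∅)
  | int (c : N) (a : α) (children : T.children t = [c]) (type : nodeType T χ t = some (.int c))
      (notMem : a ∉ χ c) (bag : insert a (χ c) = χ t)
  | rem (c : N) (a : α) (children : T.children t = [c]) (type : nodeType T χ t = some (.rem c))
      (notMem : a ∉ χ t) (bag : insert a (χ t) = χ c)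
  | join (c₁ c₂ : N) (children : T.children t = [c₁, c₂])
      (type : nodeType T χ t = some (.join c₁ c₂)) (bag₁ : χ c₁ = χ t) (bag₂ : χ c₂ = χ t)
      (bag_nonempty : (χ t).Nonempty)

theorem IsNice.nodeShape (h : IsNice T χ) (t : N) : NodeShape T χ t := by
  have htype := h.has_type t
  cases hc : T.children t with
  | nil =>
    have hleaf : nodeType T χ t = some .leaf := by simp only [nodeType, hc]
    exact .leaf hc hleaf (h.leaf_empty t hleaf)
  | cons c L =>
    cases L with
    | nil =>
      by_cases hint : χ c ⊆ χ t ∧ (χ t).card = (χ c).card + 1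
      · obtain ⟨a, ha, hbag⟩ := Finset.exists_eq_insert_iff.2 ⟨hint.1, hint.2.symm⟩
        exact .int c a hc (by simp only [nodeType, hc, if_pos hint]) ha hbag
      · by_cases hrem : χ t ⊆ χ c ∧ (χ c).card = (χ t).card + 1
        · obtain ⟨a, ha, hbag⟩ := Finset.exists_eq_insert_iff.2 ⟨hrem.1, hrem.2.symm⟩
          exact .rem c a hc (by simp only [nodeType, hc, if_neg hint, if_pos hrem]) ha hbag
        · simp only [nodeType, hc, if_neg hint, if_neg hrem, ne_eq, not_true] at htype
    | cons c' L =>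
      cases L with
      | nil =>
        by_cases hjoin : χ t = χ c ∧ χ t = χ c' ∧ χ t ≠ ∅
        · exact .join c c' hc (by simp only [nodeType, hc, if_pos hjoin]) hjoin.1.symm
            hjoin.2.1.symm (Finset.nonempty_iff_ne_empty.2 hjoin.2.2)
        · simp only [nodeType, hc, if_neg hjoin, ne_eq, not_true] at htype
      | cons => simp only [nodeType, hc, ne_eq, not_true] at htype

/-- The row `u` has the origin `L`, a list of rows of the children of `t`. -/
def IsOrigin (P : Program α) (T : OrdTree N) (χ : N → Finset α) (t : N) (L : List (Row α))
    (u : Row α) : Prop :=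
  u ∈ PHC T χ t (χ t) (bagProgram P (χ t)) (L.map ({·}))

theorem isOrigin_leaf (ht : nodeType T χ t = some .leaf) :
    IsOrigin P T χ t [] u ↔ u = (∅, ∅, []) := by
  simp only [IsOrigin, PHC, ht, Finset.mem_singleton]

theorem isOrigin_int (ht : nodeType T χ t = some (.int c)) (ha : a ∉ χ c)
    (hχ : insert a (χ c) = χ t) (hs : IsRowOf (χ c) s) :
    IsOrigin P T χ t [s] u ↔ ∃ J ρ, IsSolution (bagProgram P (χ t)) (χ t) (χ t) J ρ ∧
      Glues (χ c) s (trace (bagProgram P (χ t)) (χ t) J ρ) u := by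
  rw [← hχ, exists_isSolution_glues_iff ha hs, hχ]
  have hsdiff : χ t \ χ c = {a} := by rw [← hχ, Finset.insert_sdiff_cancel ha]
  simp only [IsOrigin, List.map_cons, List.map_nil, PHC, ht, hsdiff, Finset.singleton_biUnion,
    Finset.mem_biUnion, Finset.mem_filter, Finset.mem_insert, Finset.mem_singleton,
    Finset.mem_image]

theorem isOrigin_rem (ht : nodeType T χ t = some (.rem c)) (ha : a ∉ χ t)
    (hχ : insert a (χ t) = χ c) :
    IsOrigin P T χ t [s] u ↔
      (a ∈ s.2.1 ∨ a ∉ s.1) ∧ u = (s.1.erase a, s.2.1.erase a, s.2.2.erase a) := by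
  have hsdiff : χ c \ χ t = {a} := by rw [← hχ, Finset.insert_sdiff_cancel ha]
  simp only [IsOrigin, List.map_cons, List.map_nil, PHC, ht, hsdiff, Finset.singleton_biUnion,
    Finset.mem_image, Finset.mem_filter, Finset.mem_singleton, Finset.mem_union,
    Finset.mem_sdiff, true_and, and_assoc, exists_eq_left]
  exact and_congr_right fun _ => eq_comm

theorem isOrigin_join (ht : nodeType T χ t = some (.join c₁ c₂)) (hs : IsRowOf (χ t) s₂) :
    IsOrigin P T χ t [s₁, s₂] u ↔ Glues (χ t) s₁ s₂ u := by
  rw [glues_iff, Finset.inter_eq_left.2 hs.1, hs.2.2.filter_eq_self hs.1]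
  simp only [IsOrigin, List.map_cons, List.map_nil, PHC, ht, Finset.singleton_biUnion,
    Finset.mem_image, Finset.mem_filter, Finset.mem_singleton, and_assoc, exists_eq_left]
  refine and_congr_right fun hI => and_congr_right fun hσ => ?_
  rw [hI, hσ, eq_comm]

theorem IsOrigin.isRowOf {L : List (Row α)} (hn : IsNice T χ) (hu : IsOrigin P T χ t L u)
    (hL : List.Forall₂ (fun c s => IsRowOf (χ c) s) (T.children t) L) : IsRowOf (χ t) u := by
  rcases hn.nodeShape t with ⟨hc, ht, hχ⟩ | ⟨c, a, hc, ht, ha, hχ⟩ | ⟨c, a, hc, ht, ha, hχ⟩ |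
    ⟨c₁, c₂, hc, ht, h₁, h₂, -⟩ <;>
    simp only [hc, List.forall₂_nil_left_iff, List.forall₂_cons_left_iff] at hL
  · subst hL
    rw [hχ, isRowOf_empty_iff, ← isOrigin_leaf ht]
    exact hu
  · obtain ⟨s, _, hs, rfl, rfl⟩ := hL
    obtain ⟨J, ρ, h, hglues⟩ := (isOrigin_int ht ha hχ hs).1 hu
    exact hglues.isRowOf hs h.isRowOf_trace
  · obtain ⟨s, _, hs, rfl, rfl⟩ := hL
    obtain ⟨-, rfl⟩ := (isOrigin_rem ht ha hχ).1 hu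
    exact (hχ ▸ hs).erase
  · obtain ⟨s₁, _, hs₁, ⟨s₂, _, hs₂, rfl, rfl⟩, rfl⟩ := hL
    rw [h₁] at hs₁
    rw [h₂] at hs₂
    exact ((isOrigin_join ht hs₂).1 hu).isRowOf hs₁ hs₂

theorem exists_forall₂_cons_iff {β γ : Type*} {R : β → γ → Prop} {b : β} {l : List β}
    {p : List γ → Prop} :
    (∃ L, List.Forall₂ R (b :: l) L ∧ p L) ↔
      ∃ x, R b x ∧ ∃ L, List.Forall₂ R l L ∧ p (x :: L) := by
  simp only [List.forall₂_cons_left_iff]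
  exact ⟨fun ⟨_, ⟨x, L, hx, hL, h⟩, hp⟩ => ⟨x, hx, L, hL, h ▸ hp⟩,
    fun ⟨x, hx, L, hL, hp⟩ => ⟨_, ⟨x, L, hx, hL, rfl⟩, hp⟩⟩

theorem mem_PHC_iff {bag : Finset α} {Q : Program α} {tabs : List (Finset (Row α))}
    (hn : IsNice T χ) (hlen : tabs.length = (T.children t).length) :
    u ∈ PHC T χ t bag Q tabs ↔
      ∃ L, List.Forall₂ (fun τ s => s ∈ τ) tabs L ∧ u ∈ PHC T χ t bag Q (L.map ({·})) := by
  rcases hn.nodeShape t with ⟨hc, ht, -⟩ | ⟨c, a, hc, ht, -, -⟩ | ⟨c, a, hc, ht, -, -⟩ |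
    ⟨c₁, c₂, hc, ht, -, -, -⟩ <;> rw [hc] at hlen
  · obtain rfl := List.length_eq_zero_iff.1 hlen
    simp only [List.forall₂_nil_left_iff, exists_eq_left, List.map_nil]
  · obtain ⟨τ, rfl⟩ := List.length_eq_one_iff.1 hlen
    simp only [exists_forall₂_cons_iff, List.forall₂_nil_left_iff, exists_eq_left, List.map_cons,
      List.map_nil, PHC, ht, Finset.mem_biUnion, Finset.singleton_biUnion]
    exact ⟨fun ⟨a, ha, s, hs, h⟩ => ⟨s, hs, a, ha, h⟩, fun ⟨s, hs, a, ha, h⟩ => ⟨a, ha, s, hs, h⟩⟩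
  · obtain ⟨τ, rfl⟩ := List.length_eq_one_iff.1 hlen
    simp only [exists_forall₂_cons_iff, List.forall₂_nil_left_iff, exists_eq_left, List.map_cons,
      List.map_nil, PHC, ht, Finset.mem_biUnion, Finset.mem_image, Finset.mem_filter,
      Finset.mem_singleton, and_assoc]
    exact ⟨fun ⟨a, ha, s, hs, h⟩ => ⟨s, hs, a, ha, h⟩, fun ⟨s, hs, a, ha, h⟩ => ⟨a, ha, s, hs, h⟩⟩
  · obtain ⟨τ₁, τ₂, rfl⟩ := List.length_eq_two.1 hlen
    simp only [exists_forall₂_cons_iff, List.forall₂_nil_left_iff, exists_eq_left, List.map_cons,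
      List.map_nil, PHC, ht, Finset.mem_biUnion, Finset.mem_image, Finset.mem_filter,
      Finset.mem_singleton, and_assoc]

theorem exists_forall₂_iff_exists_ofFn {β γ : Type*} {R : β → γ → Prop} {l : List β}
    {p : List γ → Prop} :
    (∃ L, List.Forall₂ R l L ∧ p L) ↔
      ∃ f : Fin l.length → γ, (∀ i, R (l.get i) (f i)) ∧ p (List.ofFn f) := by
  constructor
  · rintro ⟨L, hL, hp⟩
    obtain ⟨hlen, hR⟩ := List.forall₂_iff_get.1 hL
    refine ⟨fun i => L.get (i.cast hlen), fun i => hR i i.2 (hlen ▸ i.2), ?_⟩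
    simpa only [List.ofFn_congr hlen, Fin.cast_cast, Fin.cast_eq_self, List.ofFn_get] using hp
  · rintro ⟨f, hf, hp⟩
    refine ⟨List.ofFn f, List.forall₂_iff_get.2 ⟨List.length_ofFn.symm, fun i hi _ => ?_⟩, hp⟩
    rw [List.get_ofFn]
    exact hf ⟨i, hi⟩

variable [Fintype N] [DecidableEq N] {I : Finset α}

theorem mem_dpPHC_iff (hn : IsNice T χ) :
    u ∈ dpPHC P T χ t ↔
      ∃ L, List.Forall₂ (fun c s => s ∈ dpPHC P T χ c) (T.children t) L ∧
        IsOrigin P T χ t L u := by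
  rw [dpPHC, dynProg_eq, mem_PHC_iff hn (List.length_map _)]
  simp only [List.forall₂_map_left_iff, IsOrigin]

theorem isRowOf_of_mem_dpPHC (hn : IsNice T χ) (hu : u ∈ dpPHC P T χ t) : IsRowOf (χ t) u := by
  induction t using T.induction generalizing u with
  | h t ih =>
    obtain ⟨L, hL, hu⟩ := (mem_dpPHC_iff hn).1 hu
    exact hu.isRowOf hn ((List.forall₂_and_left _ _).2 ⟨fun c hc => hc, hL⟩ |>.imp
      fun c s h => ih c h.1 h.2)

/-- The row `u` of the table at `t` has an extension below `t` with interpretation `I`. -/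
def Realizes (P : Program α) (T : OrdTree N) (χ : N → Finset α) (t : N) (u : Row α)
    (I : Finset α) : Prop :=
  u ∈ dpPHC P T χ t ∧ ∃ X, IsExtension P T χ (dpPHC P T χ) t u X ∧ I = X.biUnion fun p => p.2.1

theorem mem_dpPHC_iff_exists_fin (hn : IsNice T χ) :
    u ∈ dpPHC P T χ t ↔ ∃ s : Fin (T.children t).length → Row α,
      (∀ i, s i ∈ dpPHC P T χ ((T.children t).get i)) ∧ IsOrigin P T χ t (List.ofFn s) u := by
  rw [mem_dpPHC_iff hn, exists_forall₂_iff_exists_ofFn]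

theorem Realizes.exists_origin (hn : IsNice T χ) (h : Realizes P T χ t u I) :
    ∃ f : Fin (T.children t).length → Row α × Finset α,
      (∀ i, Realizes P T χ ((T.children t).get i) (f i).1 (f i).2) ∧
        IsOrigin P T χ t (List.ofFn fun i => (f i).1) u ∧
        I = u.1 ∪ Finset.univ.biUnion fun i => (f i).2 := by
  obtain ⟨hu, X, hX, rfl⟩ := h
  cases hX with
  | leaf _ _ ht =>
    have : IsEmpty (Fin (T.children t).length) := by rw [ht]; exact Fin.isEmpty
    obtain ⟨s, -, hs⟩ := (mem_dpPHC_iff_exists_fin hn).1 hu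
    refine ⟨fun i => (s i, ∅), isEmptyElim, hs, ?_⟩
    rw [Finset.singleton_biUnion, Finset.univ_eq_empty, Finset.biUnion_empty, Finset.union_empty]
  | node _ _ _ s hs X hX =>
    refine ⟨fun i => (s i, (X i).biUnion fun p => p.2.1), fun i => ⟨hs.1 i, X i, hX i, rfl⟩, ?_, ?_⟩
    · rw [IsOrigin, List.map_ofFn]
      exact hs.2
    · rw [Finset.union_biUnion, Finset.singleton_biUnion, Finset.biUnion_biUnion]

theorem realizes_of_isOrigin (hn : IsNice T χ) {f : Fin (T.children t).length → Row α × Finset α}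
    (hf : ∀ i, Realizes P T χ ((T.children t).get i) (f i).1 (f i).2)
    (hu : IsOrigin P T χ t (List.ofFn fun i => (f i).1) u) :
    Realizes P T χ t u (u.1 ∪ Finset.univ.biUnion fun i => (f i).2) := by
  choose hmem X hX hI using hf
  refine ⟨(mem_dpPHC_iff_exists_fin hn).2 ⟨_, hmem, hu⟩, ?_⟩
  by_cases ht : T.children t = []
  · have : IsEmpty (Fin (T.children t).length) := by rw [ht]; exact Fin.isEmpty
    refine ⟨{(t, u)}, .leaf t u ht, ?_⟩
    rw [Finset.singleton_biUnion, Finset.univ_eq_empty, Finset.biUnion_empty, Finset.union_empty]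
  · rw [IsOrigin, List.map_ofFn] at hu
    refine ⟨_, .node t u ht _ ⟨hmem, hu⟩ X hX, ?_⟩
    rw [Finset.union_biUnion, Finset.singleton_biUnion, Finset.biUnion_biUnion]
    simp only [hI]

theorem realizes_iff (hn : IsNice T χ) :
    Realizes P T χ t u I ↔ ∃ L : List (Row α × Finset α),
      List.Forall₂ (fun c p => Realizes P T χ c p.1 p.2) (T.children t) L ∧
        IsOrigin P T χ t (L.map Prod.fst) u ∧ I = u.1 ∪ L.toFinset.biUnion Prod.snd := by
  have hunion : ∀ {n} (f : Fin n → Row α × Finset α),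
      (List.ofFn f).toFinset.biUnion Prod.snd = Finset.univ.biUnion fun i => (f i).2 := by
    intro n f
    ext a
    simp
  rw [exists_forall₂_iff_exists_ofFn]
  simp only [List.map_ofFn, hunion]
  exact ⟨fun h => h.exists_origin hn, fun ⟨f, hf, hu, hI⟩ => hI ▸ realizes_of_isOrigin hn hf hu⟩

theorem exists_realizes (hn : IsNice T χ) (hu : u ∈ dpPHC P T χ t) :
    ∃ I, Realizes P T χ t u I := by
  induction t using T.induction generalizing u with
  | h t ih =>
    obtain ⟨s, hs, hu⟩ := (mem_dpPHC_iff_exists_fin hn).1 hu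
    choose J hJ using fun i => ih _ (List.get_mem _ i) (hs i)
    exact ⟨_, realizes_of_isOrigin hn (f := fun i => (s i, J i)) hJ hu⟩

end Origins

/-! ### Correctness of the tables -/

section Correctness

variable {α N : Type*} [DecidableEq α] [Fintype N] [DecidableEq N] {P : Program α}
  {T : OrdTree N} {χ : N → Finset α} {t c c' c₁ c₂ : N} {a : α} {A B I J : Finset α} {u : Row α}

theorem bagProgram_atoms_subset : (bagProgram P B).atoms ⊆ B :=
  Finset.biUnion_subset.2 fun _ hr => (Finset.mem_filter.1 hr).2

theorem bagProgram_subset (hAB : A ⊆ B) : bagProgram P A ⊆ bagProgram P B :=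
  Finset.monotone_filter_right P fun _ _ hr => hr.trans hAB

theorem bagProgram_empty (hP : Rule.empty ∉ P) : bagProgram P ∅ = ∅ :=
  Finset.filter_eq_empty_iff.2 fun _ hr hatoms =>
    hP (Rule.atoms_eq_empty_iff.1 (Finset.subset_empty.1 hatoms) ▸ hr)

theorem below_eq (T : OrdTree N) (t : N) :
    below T t = insert t ((T.children t).toFinset.biUnion (below T)) := by
  ext s
  simp only [mem_below, OrdTree.isBelow_iff (t := t), Finset.mem_insert, Finset.mem_biUnion,
    List.mem_toFinset]

theorem atomsBelow_eq (T : OrdTree N) (χ : N → Finset α) (t : N) :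
    atomsBelow T χ t = χ t ∪ (T.children t).toFinset.biUnion (atomsBelow T χ) := by
  unfold atomsBelow
  rw [below_eq, Finset.biUnion_insert, Finset.biUnion_biUnion]

theorem programBelow_eq (P : Program α) (T : OrdTree N) (χ : N → Finset α) (t : N) :
    programBelow P T χ t =
      bagProgram P (χ t) ∪ (T.children t).toFinset.biUnion (programBelow P T χ) := by
  unfold programBelow
  rw [below_eq, Finset.biUnion_insert, Finset.biUnion_biUnion]

theorem atomsBelow_of_children_eq_singleton (hc : T.children t = [c]) :
    atomsBelow T χ t = atomsBelow T χ c ∪ χ t := by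
  rw [atomsBelow_eq, hc, Finset.union_comm, List.toFinset_cons, List.toFinset_nil,
    Finset.biUnion_insert, Finset.biUnion_empty, Finset.union_empty]

theorem programBelow_of_children_eq_singleton (hc : T.children t = [c]) :
    programBelow P T χ t = programBelow P T χ c ∪ bagProgram P (χ t) := by
  rw [programBelow_eq, hc, Finset.union_comm, List.toFinset_cons, List.toFinset_nil,
    Finset.biUnion_insert, Finset.biUnion_empty, Finset.union_empty]

theorem programBelow_atoms_subset : (programBelow P T χ t).atoms ⊆ atomsBelow T χ t := by
  intro a ha
  simp only [Program.atoms, programBelow, Finset.biUnion_biUnion, Finset.mem_biUnion] at ha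
  obtain ⟨s, hs, r, hr, ha⟩ := ha
  exact Finset.mem_biUnion.2 ⟨s, hs, (Finset.mem_filter.1 hr).2 ha⟩

theorem bagProgram_subset_programBelow : bagProgram P (χ t) ⊆ programBelow P T χ t :=
  programBelow_eq P T χ t ▸ Finset.subset_union_left

section TreeDecomposition

variable {V : Finset α} {G : SimpleGraph α}

theorem IsTreeDecomposition.atomsBelow_inter_bag (h : IsTreeDecomposition V G T χ)
    (hc : T.IsChild t c) : atomsBelow T χ c ∩ χ t = χ c ∩ χ t := by
  refine subset_antisymm (fun v hv => ?_)
    (Finset.inter_subset_inter_right (bag_subset_atomsBelow T χ c))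
  obtain ⟨hvc, hvt⟩ := Finset.mem_inter.1 hv
  obtain ⟨s, hs, hvs⟩ := mem_atomsBelow.1 hvc
  exact Finset.mem_inter.2 ⟨(h.mem_bag_of_isChild hc hs hc.not_isBelow hvs hvt).1, hvt⟩

theorem IsTreeDecomposition.atomsBelow_inter_atomsBelow (h : IsTreeDecomposition V G T χ)
    (hc : T.IsChild t c) (hc' : T.IsChild t c') (hne : c ≠ c') :
    atomsBelow T χ c ∩ atomsBelow T χ c' ⊆ χ t := by
  intro v hv
  obtain ⟨hvc, hvc'⟩ := Finset.mem_inter.1 hv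
  obtain ⟨s, hs, hvs⟩ := mem_atomsBelow.1 hvc
  obtain ⟨s', hs', hvs'⟩ := mem_atomsBelow.1 hvc'
  have hs'c : ¬ T.IsBelow c s' := fun hs'c => hne (T.eq_of_isBelow_siblings hc hc' hs'c hs')
  exact (h.mem_bag_of_isChild hc hs hs'c hvs hvs').2

end TreeDecomposition

/-- The row `u` is the trace on the bag of `t` of a partial solution up to `t` with
interpretation `I`. -/
def IsTrace (P : Program α) (T : OrdTree N) (χ : N → Finset α) (t : N) (u : Row α)
    (I : Finset α) : Prop :=
  ∃ σ, IsSolution (programBelow P T χ t) (atomsBelow T χ t) (χ t) I σ ∧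
    u = trace (programBelow P T χ t) (χ t) I σ

theorem IsTrace.isRowOf (h : IsTrace P T χ t u I) : IsRowOf (χ t) u := by
  obtain ⟨σ, hσ, rfl⟩ := h
  exact hσ.isRowOf_trace

theorem IsTrace.fst_subset (h : IsTrace P T χ t u I) : u.1 ⊆ I := by
  obtain ⟨σ, -, rfl⟩ := h
  exact Finset.inter_subset_left

theorem isTrace_leaf (hP : Rule.empty ∉ P) (hc : T.children t = []) (hχ : χ t = ∅) :
    IsTrace P T χ t u I ↔ u = (∅, ∅, []) ∧ I = ∅ := by
  have hprogram : programBelow P T χ t = ∅ := by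
    rw [programBelow_eq, hc, hχ, bagProgram_empty hP]; rfl
  have hatoms : atomsBelow T χ t = ∅ := by rw [atomsBelow_eq, hc, hχ]; rfl
  rw [IsTrace, hprogram, hatoms, hχ]
  simp only [isSolution_self_iff, Finset.subset_empty]
  constructor
  · rintro ⟨σ, ⟨rfl, hσ, -⟩, rfl⟩
    obtain rfl := isOrdering_empty_iff.1 hσ
    exact ⟨rfl, rfl⟩
  · rintro ⟨rfl, rfl⟩
    have hmodel : IsModel (∅ : Finset α) ∅ := fun r hr => absurd hr (Finset.notMem_empty r)
    exact ⟨[], ⟨rfl, isOrdering_empty_iff.2 rfl, hmodel⟩, rfl⟩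

theorem isTrace_int (hTD : IsTreeDecomposition P.atoms (primalGraph P) T χ)
    (hc : T.children t = [c]) (ht : nodeType T χ t = some (.int c)) (ha : a ∉ χ c)
    (hχ : insert a (χ c) = χ t) :
    IsTrace P T χ t u I ↔
      ∃ s J, IsTrace P T χ c s J ∧ IsOrigin P T χ t [s] u ∧ I = u.1 ∪ J := by
  have hchild : T.IsChild t c := by simp [OrdTree.IsChild, hc]
  have hsub : χ c ⊆ χ t := hχ ▸ Finset.subset_insert a (χ c)
  have hinter : atomsBelow T χ c ∩ χ t = χ c := by
    rw [hTD.atomsBelow_inter_bag hchild, Finset.inter_eq_left.2 hsub]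
  rw [IsTrace, programBelow_of_children_eq_singleton hc, atomsBelow_of_children_eq_singleton hc,
    exists_isSolution_union_iff programBelow_atoms_subset bagProgram_atoms_subset hinter hsub
      subset_rfl]
  constructor
  · rintro ⟨J, σ, K, ρ, hJ, hK, hglues, rfl⟩
    refine ⟨_, J, ⟨σ, hJ, rfl⟩, (isOrigin_int ht ha hχ hJ.isRowOf_trace).2 ⟨K, ρ, hK, hglues⟩, ?_⟩
    rw [hglues.eq, hK.trace_eq, Finset.union_comm]
  · rintro ⟨s, J, hs, hu, rfl⟩
    obtain ⟨K, ρ, hK, hglues⟩ := (isOrigin_int ht ha hχ hs.isRowOf).1 hu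
    obtain ⟨σ, hJ, rfl⟩ := hs
    refine ⟨J, σ, K, ρ, hJ, hK, hglues, ?_⟩
    rw [hglues.eq, hK.trace_eq, Finset.union_comm]

theorem isTrace_rem (hc : T.children t = [c]) (ht : nodeType T χ t = some (.rem c))
    (ha : a ∉ χ t) (hχ : insert a (χ t) = χ c) :
    IsTrace P T χ t u I ↔
      ∃ s J, IsTrace P T χ c s J ∧ IsOrigin P T χ t [s] u ∧ I = u.1 ∪ J := by
  have hsub : χ t ⊆ χ c := hχ ▸ Finset.subset_insert a (χ t)
  have hac : a ∈ χ c := hχ ▸ Finset.mem_insert_self a (χ t)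
  have hprogram : programBelow P T χ t = programBelow P T χ c := by
    rw [programBelow_of_children_eq_singleton hc, Finset.union_eq_left]
    exact (bagProgram_subset hsub).trans bagProgram_subset_programBelow
  have hatoms : atomsBelow T χ t = atomsBelow T χ c := by
    rw [atomsBelow_of_children_eq_singleton hc, Finset.union_eq_left]
    exact hsub.trans (bag_subset_atomsBelow T χ c)
  have horigin : ∀ {J σ}, IsOrigin P T χ t [trace (programBelow P T χ c) (χ c) J σ] u ↔
      (a ∈ gatherProof J σ (programBelow P T χ c) ∨ a ∉ J) ∧ _ := fun {J σ} => by
    rw [isOrigin_rem ht ha hχ, trace, Finset.mem_inter, and_iff_left hac, Finset.mem_inter,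
      and_iff_left hac]
  constructor
  · rintro ⟨σ, hσ, rfl⟩
    have hI := Finset.union_eq_right.2 (IsTrace.fst_subset ⟨σ, hσ, rfl⟩)
    rw [hprogram, hatoms, isSolution_iff_insert ha, hχ] at hσ
    refine ⟨_, I, ⟨σ, hσ.1, rfl⟩, horigin.2 ⟨hσ.2, ?_⟩, hI.symm⟩
    rw [hprogram, trace_insert hσ.1.ordering.1 ha, hχ]
    rfl
  · rintro ⟨_, J, ⟨σ, hσ, rfl⟩, hu, rfl⟩
    obtain ⟨haJ, rfl⟩ := horigin.1 hu
    rw [Finset.union_eq_right.2 ((Finset.erase_subset a _).trans Finset.inter_subset_left)]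
    refine ⟨σ, ?_, ?_⟩
    · rw [hprogram, hatoms, isSolution_iff_insert ha, hχ]
      exact ⟨hσ, haJ⟩
    · rw [hprogram, trace_insert hσ.ordering.1 ha, hχ]
      rfl

theorem atomsBelow_eq_union (hc : T.children t = [c₁, c₂]) (h₁ : χ c₁ = χ t) :
    atomsBelow T χ t = atomsBelow T χ c₁ ∪ atomsBelow T χ c₂ := by
  have hbag : χ t ⊆ atomsBelow T χ c₁ := h₁ ▸ bag_subset_atomsBelow T χ c₁
  rw [atomsBelow_eq, hc]
  simp [← Finset.union_assoc, Finset.union_eq_right.2 hbag]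

theorem programBelow_eq_union (hc : T.children t = [c₁, c₂]) (h₁ : χ c₁ = χ t) :
    programBelow P T χ t = programBelow P T χ c₁ ∪ programBelow P T χ c₂ := by
  have hbag : bagProgram P (χ t) ⊆ programBelow P T χ c₁ := h₁ ▸ bagProgram_subset_programBelow
  rw [programBelow_eq, hc]
  simp [← Finset.union_assoc, Finset.union_eq_right.2 hbag]

theorem isTrace_join (hTD : IsTreeDecomposition P.atoms (primalGraph P) T χ)
    (hc : T.children t = [c₁, c₂]) (ht : nodeType T χ t = some (.join c₁ c₂))
    (h₁ : χ c₁ = χ t) (h₂ : χ c₂ = χ t) :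
    IsTrace P T χ t u I ↔ ∃ s₁ J₁, IsTrace P T χ c₁ s₁ J₁ ∧ ∃ s₂ J₂, IsTrace P T χ c₂ s₂ J₂ ∧
      IsOrigin P T χ t [s₁, s₂] u ∧ I = u.1 ∪ (J₁ ∪ J₂) := by
  have hne : c₁ ≠ c₂ := by simpa [hc] using T.nodup_children t
  have hbag₁ : χ t ⊆ atomsBelow T χ c₁ := h₁ ▸ bag_subset_atomsBelow T χ c₁
  have hbag₂ : χ t ⊆ atomsBelow T χ c₂ := h₂ ▸ bag_subset_atomsBelow T χ c₂
  have hinter : atomsBelow T χ c₁ ∩ atomsBelow T χ c₂ = χ t :=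
    subset_antisymm (hTD.atomsBelow_inter_atomsBelow (by simp [OrdTree.IsChild, hc])
      (by simp [OrdTree.IsChild, hc]) hne) (Finset.subset_inter hbag₁ hbag₂)
  have hI : ∀ {s₁ s₂ : Row α} {J₁ J₂}, IsTrace P T χ c₂ s₂ J₂ → Glues (χ t) s₁ s₂ u →
      u.1 ∪ (J₁ ∪ J₂) = J₁ ∪ J₂ := fun {s₁ s₂ J₁ J₂} hs₂ hglues => by
    rw [Finset.union_eq_right, hglues.eq]
    exact hs₂.fst_subset.trans Finset.subset_union_right
  rw [IsTrace, programBelow_eq_union hc h₁, atomsBelow_eq_union hc h₁,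
    exists_isSolution_union_iff programBelow_atoms_subset programBelow_atoms_subset hinter
      subset_rfl hbag₂]
  constructor
  · rintro ⟨J₁, σ₁, J₂, σ₂, hJ₁, hJ₂, hglues, rfl⟩
    rw [← h₁] at hJ₁
    rw [← h₂] at hJ₂
    have hs₂ : IsTrace P T χ c₂ _ J₂ := ⟨σ₂, hJ₂, rfl⟩
    rw [h₂] at hs₂
    refine ⟨_, J₁, ⟨σ₁, hJ₁, rfl⟩, _, J₂, ⟨σ₂, hJ₂, rfl⟩, ?_, ?_⟩
    · rw [h₁, h₂]
      exact (isOrigin_join ht (h₂ ▸ hs₂.isRowOf)).2 hglues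
    · exact (hI hs₂ hglues).symm
  · rintro ⟨s₁, J₁, ⟨σ₁, hJ₁, rfl⟩, s₂, J₂, hs₂, hu, rfl⟩
    have hglues := (isOrigin_join ht (h₂ ▸ hs₂.isRowOf)).1 hu
    rw [hI hs₂ hglues]
    obtain ⟨σ₂, hJ₂, rfl⟩ := hs₂
    rw [h₁] at hJ₁ hglues
    rw [h₂] at hJ₂ hglues
    exact ⟨J₁, σ₁, J₂, σ₂, hJ₁, hJ₂, hglues, rfl⟩

theorem isTrace_iff (hTD : IsTreeDecomposition P.atoms (primalGraph P) T χ) (hn : IsNice T χ)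
    (hP : Rule.empty ∉ P) :
    IsTrace P T χ t u I ↔ ∃ L : List (Row α × Finset α),
      List.Forall₂ (fun c p => IsTrace P T χ c p.1 p.2) (T.children t) L ∧
        IsOrigin P T χ t (L.map Prod.fst) u ∧ I = u.1 ∪ L.toFinset.biUnion Prod.snd := by
  rcases hn.nodeShape t with ⟨hc, ht, hχ⟩ | ⟨c, a, hc, ht, ha, hχ⟩ | ⟨c, a, hc, ht, ha, hχ⟩ |
    ⟨c₁, c₂, hc, ht, h₁, h₂, -⟩ <;>
    simp only [hc, exists_forall₂_cons_iff, List.forall₂_nil_left_iff, exists_eq_left,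
      List.map_cons, List.map_nil, List.toFinset_cons, List.toFinset_nil,
      Finset.biUnion_insert, Finset.biUnion_empty, Finset.union_empty]
  · rw [isTrace_leaf hP hc hχ, isOrigin_leaf ht]
    exact and_congr_right fun hu => by rw [hu]
  · simp only [isTrace_int hTD hc ht ha hχ, Prod.exists]
  · simp only [isTrace_rem hc ht ha hχ, Prod.exists]
  · simp only [isTrace_join hTD hc ht h₁ h₂, Prod.exists]

theorem forall₂_congr_of_mem {β γ : Type*} {R S : β → γ → Prop} {l : List β} {L : List γ}
    (h : ∀ b ∈ l, ∀ x, R b x ↔ S b x) : List.Forall₂ R l L ↔ List.Forall₂ S l L := by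
  simp only [List.forall₂_iff_get]
  exact and_congr_right fun _ => forall₃_congr fun i hi _ => h _ (List.get_mem l ⟨i, hi⟩) _

theorem realizes_iff_isTrace (hTD : IsTreeDecomposition P.atoms (primalGraph P) T χ)
    (hn : IsNice T χ) (hP : Rule.empty ∉ P) : Realizes P T χ t u I ↔ IsTrace P T χ t u I := by
  induction t using T.induction generalizing u I with
  | h t ih =>
    rw [realizes_iff hn, isTrace_iff hTD hn hP]
    have hchildren : ∀ L : List (Row α × Finset α),
        List.Forall₂ (fun c p => Realizes P T χ c p.1 p.2) (T.children t) L ↔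
        List.Forall₂ (fun c p => IsTrace P T χ c p.1 p.2) (T.children t) L := fun L =>
      forall₂_congr_of_mem fun c hc p => ih c hc
    simp only [hchildren]

theorem atomsBelow_eq_empty_of_mem_dpPHC (hn : IsNice T χ) (hP : Rule.empty ∈ P)
    (hu : u ∈ dpPHC P T χ t) : atomsBelow T χ t = ∅ := by
  induction t using T.induction generalizing u with
  | h t ih =>
    obtain ⟨L, hL, hu⟩ := (mem_dpPHC_iff hn).1 hu
    rcases hn.nodeShape t with ⟨hc, -, hχ⟩ | ⟨c, a, hc, ht, ha, hχ⟩ | ⟨c, a, hc, -, -, hχ⟩ |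
      ⟨c₁, c₂, hc, -, h₁, -, hbag⟩ <;>
      simp only [hc, List.forall₂_nil_left_iff, List.forall₂_cons_left_iff] at hL ih
    · rw [atomsBelow_eq, hc, hχ]
      rfl
    · obtain ⟨s, _, hs, rfl, rfl⟩ := hL
      obtain ⟨J, ρ, h, -⟩ := (isOrigin_int ht ha hχ (isRowOf_of_mem_dpPHC hn hs)).1 hu
      exact absurd (h.model _ (Finset.mem_filter.2 ⟨hP, by simp [Rule.empty, Rule.atoms]⟩))
        (Rule.not_sat_empty J)
    · obtain ⟨s, _, hs, -⟩ := hL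
      have hχc := bag_subset_atomsBelow T χ c
      rw [ih c (List.mem_singleton_self c) hs, ← hχ] at hχc
      exact absurd (hχc (Finset.mem_insert_self a _)) (Finset.notMem_empty a)
    · obtain ⟨s₁, _, hs₁, -⟩ := hL
      have hχc := bag_subset_atomsBelow T χ c₁
      rw [ih c₁ List.mem_cons_self hs₁, h₁, Finset.subset_empty] at hχc
      exact absurd hχc hbag.ne_empty

/-! ### Answer sets from the root -/

theorem exists_isPHCSolution_iff :
    (∃ Q σ, IsPHCSolution P T χ t I Q σ) ↔
      ∃ σ, IsSolution (programBelow P T χ t) (atomsBelow T χ t) (χ t) I σ := by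
  have hsdiff : I ⊆ atomsBelow T χ t → I ∩ (atomsBelow T χ t \ χ t) = I \ χ t := fun hI => by
    rw [← Finset.inter_sdiff_assoc, Finset.inter_eq_left.2 hI]
  constructor
  · rintro ⟨Q, σ, h⟩
    refine ⟨σ, h.subset_atoms, h.ordering, h.model, fun a ha => ?_⟩
    rw [← hsdiff h.subset_atoms] at ha
    exact (proven_iff.1 ((h.mem_iff a).1 (h.strictly_below a ha))).2
  · rintro ⟨σ, h⟩
    refine ⟨I ∩ gatherProof I σ (programBelow P T χ t), σ, h.subset, Finset.inter_subset_left,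
      h.ordering, h.model, fun a ha => ?_, fun a => by rw [Finset.mem_inter, proven_iff]⟩
    rw [hsdiff h.subset] at ha
    exact Finset.mem_inter.2 ⟨Finset.sdiff_subset ha, h.proven ha⟩

theorem exists_isSolution_empty_iff (hP : HeadCycleFree P) :
    (∃ σ, IsSolution P P.atoms ∅ I σ) ↔ IsAnswerSet P I := by
  rw [hP.isAnswerSet_iff]
  constructor
  · rintro ⟨σ, h⟩
    exact ⟨h.subset, h.model, σ, h.ordering, by simpa only [Finset.sdiff_empty] using h.proven⟩
  · rintro ⟨hI, hmodel, σ, hσ, hproven⟩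
    exact ⟨σ, hI, hσ, hmodel, Finset.sdiff_subset.trans hproven⟩

theorem Rule.isClique_atoms {r : Rule α} (hr : r ∈ P) :
    (primalGraph P).IsClique (r.atoms : Set α) :=
  fun _ ha _ hb hab => ⟨hab, r, hr, ha, hb⟩

theorem IsTreeDecomposition.programBelow_root
    (h : IsTreeDecomposition P.atoms (primalGraph P) T χ) : programBelow P T χ T.root = P := by
  refine subset_antisymm (Finset.biUnion_subset.2 fun s _ => Finset.filter_subset _ P) ?_
  intro r hr
  obtain ⟨s, hs⟩ := h.exists_clique_subset_bag (Rule.atoms_subset_atoms hr) (Rule.isClique_atoms hr)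
  exact Finset.mem_biUnion.2 ⟨s, mem_below.2 (T.isBelow_root s), Finset.mem_filter.2 ⟨hr, hs⟩⟩

theorem eq_singleton_empty_of_atoms_eq_empty (hP : Rule.empty ∈ P) (hatoms : P.atoms = ∅) :
    P = {Rule.empty} :=
  Finset.eq_singleton_iff_unique_mem.2 ⟨hP, fun _ hr =>
    Rule.atoms_eq_empty_iff.1 (Finset.subset_empty.1 (hatoms ▸ Rule.atoms_subset_atoms hr))⟩

theorem realizes_root_iff (hP : HeadCycleFree P) (hne : P ≠ {Rule.empty})
    (hTD : IsTreeDecomposition P.atoms (primalGraph P) T χ) (hn : IsNice T χ) :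
    Realizes P T χ T.root u I ↔ u = (∅, ∅, []) ∧ IsAnswerSet P I := by
  by_cases hempty : Rule.empty ∈ P
  · have hatoms : P.atoms ≠ ∅ := mt (eq_singleton_empty_of_atoms_eq_empty hempty) hne
    refine iff_of_false (fun h => hatoms ?_) fun h => ?_
    · rw [← hTD.atomsBelow_root, atomsBelow_eq_empty_of_mem_dpPHC hn hempty h.1]
    · exact Rule.not_sat_empty I ((hP.isAnswerSet_iff.1 h.2).2.1 _ hempty)
  · rw [realizes_iff_isTrace hTD hn hempty, ← exists_isSolution_empty_iff hP, IsTrace,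
      hTD.programBelow_root, hTD.atomsBelow_root, hn.root_empty, ← exists_and_left]
    refine exists_congr fun σ => ?_
    rw [and_comm]
    exact and_congr_left fun h => by rw [isRowOf_empty_iff.1 h.isRowOf_trace]

theorem interpretations_extensions :
    interpretations (extensions P T χ (dpPHC P T χ) t (dpPHC P T χ t)) =
      {I | ∃ u, Realizes P T χ t u I} := by
  ext I
  exact ⟨fun ⟨X, ⟨u, hu, hX⟩, hI⟩ => ⟨u, hu, X, hX, hI⟩, fun ⟨u, hu, X, hX, hI⟩ =>
    ⟨X, ⟨u, hu, hX⟩, hI⟩⟩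

end Correctness

end ASP

theorem theorem2 {α N : Type*} [DecidableEq α] [Fintype N] [DecidableEq N]
    (P : ASP.Program α) (hP : ASP.HeadCycleFree P) (hne : P ≠ {ASP.Rule.empty})
    (T : ASP.OrdTree N) (χ : N → Finset α)
    (hTD : ASP.IsTreeDecomposition P.atoms (ASP.primalGraph P) T χ)
    (hnice : ASP.IsNice T χ) :
    let τ : N → Finset (ASP.Row α) := ASP.dpPHC P T χ
    (∀ t, ∀ u ∈ τ t, u.1 ⊆ χ t ∧ u.2.1 ⊆ u.1 ∧ ASP.IsOrdering u.2.2 u.1) ∧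
    ((∃ I, ASP.IsAnswerSet P I) ↔ ((∅, ∅, []) : ASP.Row α) ∈ τ T.root) ∧
    ASP.interpretations (ASP.extensions P T χ τ T.root (τ T.root)) =
      {I | ∃ Q σ, ASP.IsPHCSolution P T χ T.root I Q σ} ∧
    {I | ∃ Q σ, ASP.IsPHCSolution P T χ T.root I Q σ} = {I | ASP.IsAnswerSet P I} := by
  intro τ
  have hrow : ∀ t, ∀ u ∈ τ t, ASP.IsRowOf (χ t) u := fun t u => ASP.isRowOf_of_mem_dpPHC hnice
  have hroot : ∀ u I, ASP.Realizes P T χ T.root u I ↔ u = (∅, ∅, []) ∧ ASP.IsAnswerSet P I :=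
    fun u I => ASP.realizes_root_iff hP hne hTD hnice
  have hinterpretations : ASP.interpretations (ASP.extensions P T χ τ T.root (τ T.root)) =
      {I | ASP.IsAnswerSet P I} := by
    simp only [τ, ASP.interpretations_extensions, hroot, exists_eq_left]
  have hsolution : {I | ∃ Q σ, ASP.IsPHCSolution P T χ T.root I Q σ} =
      {I | ASP.IsAnswerSet P I} := by
    simp only [ASP.exists_isPHCSolution_iff, hTD.programBelow_root, hTD.atomsBelow_root,
      hnice.root_empty, ASP.exists_isSolution_empty_iff hP]
  refine ⟨hrow, ⟨fun ⟨I, hI⟩ => ((hroot _ I).2 ⟨rfl, hI⟩).1, fun hu => ?_⟩,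
    hinterpretations.trans hsolution.symm, hsolution⟩
  obtain ⟨I, hI⟩ := ASP.exists_realizes hnice hu
  exact ⟨I, ((hroot _ I).1 hI).2⟩
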